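/- Let $(\Omega,\mathcal F,P)$ be a probability space with a filtration $(\mathcal F_t)_{t\in[0,T]}$, $T<\infty$, satisfying the usual conditions (right-continuity, and $\mathcal F_0$ contains all $P$-null sets), let $d\in\mathbb N$ and $1<p\le\infty$. $L^0(\mathcal F_0,R^d)$ denotes the classes of $\mathcal F_0$-measurable $R^d$-valued random vectors, $L^0(\mathcal F_0)=L^0(\mathcal F_0,R^1)$. A random variable $X$ is *conditionally integrable* with respect to a sub-$\sigma$-algebra $\mathcal E\subset\mathcal F$ if there are $A_1\subset A_2\subset\dots$ in $\mathcal E$ with $\bigcup_nA_n=\Omega$ and $E(|X|1_{A_n})<\infty$ for all $n$; then $E[X\,|\,\mathcal E]$ is the a.s. unique $\mathcal E$-measurable real random variable $Y$ with $E(X1_A)=E(Y1_A)$ for all $A\in\mathcal E$ such that $E(|X|1_A)<\infty$. For random vectors this is understood componentwise. Write $E_t(V)=E[V\,|\,\mathcal F_t]$. * $L^p_{\mathcal F_0}(\mathcal F_T,R^d)=\{\eta x:\ \eta\in L^0(\mathcal F_0),\ x\in L^p(\mathcal F_T,R^d)\}$. * $S^p_{\mathcal F_0}$ is the set of $R^d$-valued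 right-continuous adapted processes with left limits $Y=(Y_t)_{t\in[0,T]}$, identified when $Y_t=Y'_t$ a.s. for every $t$, such that $(\sup_t|Y_t|)^p$ is conditionally integrable with respect to $\mathcal F_0$ if $p<\infty$, and such that $\sup_t|Y_t|$ is a.s. dominated by a real-valued $\mathcal F_0$-measurable random variable if $p=\infty$; $S^p_{\mathcal F_0,0}=\{Y\in S^p_{\mathcal F_0}:Y_0=0\}$. * $M^p_{\mathcal F_0,0}$ is the set of $M\in S^p_{\mathcal F_0,0}$ that are generalized martingales: for $s<t$, $M_t$ is conditionally integrable with respect to $\mathcal F_s$ and $E[M_t\,|\,\mathcal F_s]=M_s$ a.s. Let $F:S^p_{\mathcal F_0}\times M^p_{\mathcal F_0,0}\to S^p_{\mathcal F_0,0}$ satisfy condition (S): for all $y\in L^0(\mathcal F_0,R^d)$ and $M\in M^p_{\mathcal F_0,0}$ the equation $Y_t=y-F_t(Y,M)-M_t$, $t\in[0,T]$, has a unique solution $Y\in S^p_{\mathcal F_0}$. Let $\xi\in L^p_{\mathcal F_0}(\mathcal F_T,R^d)$, and consider the backward stochastic equation (BSE) $$Y_t+F_t(Y,M)+M_t=\xi+F_T(Y,M)+M_T,\qquad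 t\in[0,T],$$ for $(Y,M)\in S^p_{\mathcal F_0}\times M^p_{\mathcal F_0,0}$. Then for every $V\in L^p_{\mathcal F_0}(\mathcal F_T,R^d)$ the generalized conditional expectations $E_t(V)$ exist and are a.s. unique, $E_0(V)\in L^0(\mathcal F_0,R^d)$, the process $M^V_t:=E_0(V)-E_t(V)$ belongs to $M^p_{\mathcal F_0,0}$, and hence there is a unique $Y^V\in S^p_{\mathcal F_0}$ with $Y^V_t=E_0(V)-F_t(Y^V,M^V)-M^V_t$ for all $t\in[0,T]$. Put $\phi(V)=(Y^V,M^V)$, $G(V)=\xi+F_T(Y^V,M^V)$ and $\pi(Y,M)=Y_0-M_T$. These are maps $$\phi:L^p_{\mathcal F_0}(\mathcal F_T,R^d)\to S^p_{\mathcal F_0}\times M^p_{\mathcal F_0,0},\quad \pi:S^p_{\mathcal F_0}\times M^p_{\mathcal F_0,0}\to L^p_{\mathcal F_0}(\mathcal F_T,R^d),\quad G:L^p_{\mathcal F_0}(\mathcal F_T,R^d)\to L^p_{\mathcal F_0}(\mathcal F_T,R^d),$$ and the following hold. (a) $V=(\pi\circ\phi)(V)$ for all $V\in L^p_{\mathcal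 F_0}(\mathcal F_T,R^d)$; in particular $\phi$ is injective. (b) If $V\in L^p_{\mathcal F_0}(\mathcal F_T,R^d)$ is a fixed point of $G$, then $\phi(V)$ is a solution of the BSE. (c) If $(Y,M)\in S^p_{\mathcal F_0}\times M^p_{\mathcal F_0,0}$ solves the BSE, then $\pi(Y,M)$ is a fixed point of $G$ and $(Y,M)=(\phi\circ\pi)(Y,M)$. Consequently $\phi$ and $\pi$ restrict to mutually inverse bijections between the fixed points of $G$ and the solutions of the BSE. (d) For $V\in L^p_{\mathcal F_0}(\mathcal F_T,R^d)$: $V$ is the unique fixed point of $G$ in $L^p_{\mathcal F_0}(\mathcal F_T,R^d)$ if and only if $\phi(V)$ is the unique solution of the BSE in $S^p_{\mathcal F_0}\times M^p_{\mathcal F_0,0}$. -/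

import Mathlib

open MeasureTheory Filter Topology
open scoped ENNReal NNReal

noncomputable section

namespace BSE

/-- The time interval `[0,T]`; its least element `⊥` is the time `0` and its greatest element `⊤`
is the time `T`. -/
abbrev Time (T : ℝ≥0) : Type := Set.Iic T

/-- `R^d` with the Euclidean norm. -/
abbrev Vec (d : ℕ) : Type := EuclideanSpace ℝ (Fin d)

variable {Ω : Type*} (m : MeasurableSpace Ω) [mΩ : MeasurableSpace Ω] {T : ℝ≥0} {d : ℕ}

/-- The usual conditions: the filtration is right-continuous and `𝓕_0` contains every `P`-null set
(so that, in particular, the probability space is complete; note that in Mathlib `P s` is the outer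
measure of `s` when `s` is not measurable). -/
structure UsualConditions (P : Measure Ω) (𝓕 : Filtration (Time T) mΩ) : Prop where
  rightContinuous : 𝓕.IsRightContinuous
  null_mem : ∀ s : Set Ω, P s = 0 → MeasurableSet[𝓕 ⊥] s

/-! ### Generalized conditional expectation -/

/-- A nonnegative extended real function `g` is conditionally integrable (`σ`-integrable) with
respect to the sub-`σ`-algebra `m`: there is a nondecreasing sequence `A n` in `m` with union `Ω`
and with finite integral of `g` over every `A n`. -/
def CondIntegrable (P : Measure Ω) (g : Ω → ℝ≥0∞) : Prop :=
  ∃ A : ℕ → Set Ω, Monotone A ∧ (∀ n, MeasurableSet[m] (A n)) ∧ (⋃ n, A n) = Set.univ ∧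
    ∀ n, ∫⁻ ω in A n, g ω ∂P < ∞

/-- `Y` is a generalized conditional expectation of the real random variable `X` given `m`:
`X` is conditionally integrable, `Y` is `m`-measurable (up to a null set), and
`E[X 1_A] = E[Y 1_A]` for every `A ∈ m` with `E[|X| 1_A] < ∞`. -/
structure IsGenCondExpReal (P : Measure Ω) (X Y : Ω → ℝ) : Prop where
  aestronglyMeasurable : AEStronglyMeasurable X P
  condIntegrable : CondIntegrable m P (fun ω => ‖X ω‖ₑ)
  aestronglyMeasurable_condExp : AEStronglyMeasurable[m] Y P
  setIntegral_eq : ∀ A : Set Ω, MeasurableSet[m] A → IntegrableOn X A P →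
    IntegrableOn Y A P ∧ ∫ ω in A, X ω ∂P = ∫ ω in A, Y ω ∂P

/-- The generalized conditional expectation of a random vector is taken componentwise. -/
def IsGenCondExp (P : Measure Ω) (X Y : Ω →ₘ[P] Vec d) : Prop :=
  ∀ i : Fin d, IsGenCondExpReal m P (fun ω => X ω i) (fun ω => Y ω i)

/-- `E[X | m]`: the (a.s. unique) generalized conditional expectation of `X` given `m`, with an
irrelevant value if there is none. -/
def genCondExp (P : Measure Ω) (X : Ω →ₘ[P] Vec d) : Ω →ₘ[P] Vec d :=
  Classical.epsilon fun Y => IsGenCondExp m P X Y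

/-! ### Random vectors -/

/-- `L^0(m, R^d)`: equivalence classes of `m`-measurable random vectors. -/
def L0 (P : Measure Ω) (d : ℕ) : Set (Ω →ₘ[P] Vec d) :=
  {y | AEStronglyMeasurable[m] y P}

/-- `L^p_{𝓕_0}(𝓕_T, R^d)`, the `L^0(𝓕_0)`-module generated by `L^p(𝓕_T, R^d)`: the products
`ξ x` with `ξ ∈ L^0(𝓕_0)` and `x ∈ L^p(𝓕_T, R^d)`. -/
def LpMod (P : Measure Ω) (𝓕 : Filtration (Time T) mΩ) (d : ℕ) (p : ℝ≥0∞) :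
    Set (Ω →ₘ[P] Vec d) :=
  {V | ∃ (ξ : Ω → ℝ) (x : Ω → Vec d), StronglyMeasurable[𝓕 ⊥] ξ ∧ StronglyMeasurable[𝓕 ⊤] x ∧
    MemLp x p P ∧ V =ᵐ[P] fun ω => ξ ω • x ω}

/-! ### Processes

Two processes `X`, `X'` are identified when `X_t = X'_t` a.s. for every `t ∈ [0,T]`, so the
equivalence class of `X` is the same thing as the family `t ↦ [X_t]` of equivalence classes of
random vectors. -/

/-- Equivalence classes of `R^d`-valued processes on `[0,T]`. -/
abbrev Proc (P : Measure Ω) (T : ℝ≥0) (d : ℕ) : Type _ := Time T → (Ω →ₘ[P] Vec d)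

/-- `X` is an adapted process all of whose paths are right-continuous with left limits. -/
structure IsRCLLAdapted (𝓕 : Filtration (Time T) mΩ) (X : Time T → Ω → Vec d) : Prop where
  adapted : StronglyAdapted 𝓕 X
  rightContinuous : ∀ ω t, ContinuousWithinAt (fun s => X s ω) (Set.Ioi t) t
  leftLimit : ∀ ω t, ∃ l, Tendsto (fun s => X s ω) (𝓝[<] t) (𝓝 l)

/-- The condition on a nonnegative extended random variable `g` that its conditional `p`-norm
given `m` be finite a.s.: for `p < ∞`, `g ^ p` is conditionally integrable; for `p = ∞`, `g` is
dominated by a real-valued `m`-measurable random variable, in other words the essential infimum of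
the `m`-measurable `η ≥ g` is real-valued. -/
def CondLpFinite (P : Measure Ω) (p : ℝ≥0∞) (g : Ω → ℝ≥0∞) : Prop :=
  (p ≠ ∞ → CondIntegrable m P (fun ω => g ω ^ p.toReal)) ∧
  (p = ∞ → ∃ η : Ω → ℝ, StronglyMeasurable[m] η ∧ ∀ᵐ ω ∂P, g ω ≤ ENNReal.ofReal (η ω))

/-- `S^p_{𝓕_0}`: classes of RCLL adapted processes `Y` such that `sup_t |Y_t|` has a finite
conditional `p`-norm given `𝓕_0`. -/
def Sp (P : Measure Ω) (𝓕 : Filtration (Time T) mΩ) (d : ℕ) (p : ℝ≥0∞) : Set (Proc P T d) :=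
  {Y | ∃ X : Time T → Ω → Vec d, IsRCLLAdapted 𝓕 X ∧ (∀ t, Y t =ᵐ[P] X t) ∧
    CondLpFinite (𝓕 ⊥) P p (fun ω => ⨆ t, ‖X t ω‖ₑ)}

/-- `S^p_{𝓕_0,0}`: the elements of `S^p_{𝓕_0}` starting from `0`. -/
def Sp0 (P : Measure Ω) (𝓕 : Filtration (Time T) mΩ) (d : ℕ) (p : ℝ≥0∞) : Set (Proc P T d) :=
  {Y | Y ∈ Sp P 𝓕 d p ∧ Y ⊥ = 0}

/-- `Y` is a generalized martingale: for `s < t`, `Y_t` is conditionally integrable with respect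
to `𝓕_s` and `E[Y_t | 𝓕_s] = Y_s`. (Adaptedness is part of `Sp`.) -/
def IsGenMartingale (P : Measure Ω) (𝓕 : Filtration (Time T) mΩ) (Y : Proc P T d) : Prop :=
  ∀ s t : Time T, s < t → IsGenCondExp (𝓕 s) P (Y t) (Y s)

/-- `M^p_{𝓕_0,0}`: the generalized martingales in `S^p_{𝓕_0,0}`. -/
def Mp0 (P : Measure Ω) (𝓕 : Filtration (Time T) mΩ) (d : ℕ) (p : ℝ≥0∞) : Set (Proc P T d) :=
  {M | M ∈ Sp0 P 𝓕 d p ∧ IsGenMartingale P 𝓕 M}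

/-! ### The backward stochastic equation -/

/-- `Y ∈ S^p_{𝓕_0}` solves the forward equation `Y_t = y - F_t(Y,M) - M_t`, `t ∈ [0,T]`. -/
def IsForwardSol (P : Measure Ω) (𝓕 : Filtration (Time T) mΩ) (p : ℝ≥0∞)
    (F : Proc P T d → Proc P T d → Proc P T d) (y : Ω →ₘ[P] Vec d) (M Y : Proc P T d) : Prop :=
  Y ∈ Sp P 𝓕 d p ∧ ∀ t, Y t = y - F Y M t - M t

/-- Condition (S): for all `y ∈ L^0(𝓕_0, R^d)` and `M ∈ M^p_{𝓕_0,0}`, the forward equation has a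
unique solution in `S^p_{𝓕_0}`. -/
def ConditionS (P : Measure Ω) (𝓕 : Filtration (Time T) mΩ) (p : ℝ≥0∞)
    (F : Proc P T d → Proc P T d → Proc P T d) : Prop :=
  ∀ y ∈ L0 (𝓕 ⊥) P d, ∀ M ∈ Mp0 P 𝓕 d p, ∃! Y, IsForwardSol P 𝓕 p F y M Y

/-- `M^V_t = E[V | 𝓕_0] - E[V | 𝓕_t]`. -/
def MV (P : Measure Ω) (𝓕 : Filtration (Time T) mΩ) (V : Ω →ₘ[P] Vec d) : Proc P T d :=
  fun t => genCondExp (𝓕 ⊥) P V - genCondExp (𝓕 t) P V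

/-- `Y^V`: the solution of `Y_t = E[V | 𝓕_0] - F_t(Y, M^V) - M^V_t`, unique under condition (S). -/
def YV (P : Measure Ω) (𝓕 : Filtration (Time T) mΩ) (p : ℝ≥0∞)
    (F : Proc P T d → Proc P T d → Proc P T d) (V : Ω →ₘ[P] Vec d) : Proc P T d :=
  Classical.epsilon fun Y => IsForwardSol P 𝓕 p F (genCondExp (𝓕 ⊥) P V) (MV P 𝓕 V) Y

/-- `φ(V) = (Y^V, M^V)`. -/
def phi (P : Measure Ω) (𝓕 : Filtration (Time T) mΩ) (p : ℝ≥0∞)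
    (F : Proc P T d → Proc P T d → Proc P T d) (V : Ω →ₘ[P] Vec d) : Proc P T d × Proc P T d :=
  (YV P 𝓕 p F V, MV P 𝓕 V)

/-- `π(Y,M) = Y_0 - M_T`. -/
def proj (P : Measure Ω) (YM : Proc P T d × Proc P T d) : Ω →ₘ[P] Vec d :=
  YM.1 ⊥ - YM.2 ⊤

/-- `G(V) = ξ + F_T(Y^V, M^V)`. -/
def G (P : Measure Ω) (𝓕 : Filtration (Time T) mΩ) (p : ℝ≥0∞)
    (F : Proc P T d → Proc P T d → Proc P T d) (ξ V : Ω →ₘ[P] Vec d) : Ω →ₘ[P] Vec d :=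
  ξ + F (YV P 𝓕 p F V) (MV P 𝓕 V) ⊤

/-- The fixed points of `G` in `L^p_{𝓕_0}(𝓕_T, R^d)`. -/
def FixG (P : Measure Ω) (𝓕 : Filtration (Time T) mΩ) (p : ℝ≥0∞)
    (F : Proc P T d → Proc P T d → Proc P T d) (ξ : Ω →ₘ[P] Vec d) : Set (Ω →ₘ[P] Vec d) :=
  {V | V ∈ LpMod P 𝓕 d p ∧ G P 𝓕 p F ξ V = V}

/-- The solutions `(Y,M) ∈ S^p_{𝓕_0} × M^p_{𝓕_0,0}` of the backward stochastic equation
`Y_t + F_t(Y,M) + M_t = ξ + F_T(Y,M) + M_T`, `t ∈ [0,T]`. -/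
def Sol (P : Measure Ω) (𝓕 : Filtration (Time T) mΩ) (p : ℝ≥0∞)
    (F : Proc P T d → Proc P T d → Proc P T d) (ξ : Ω →ₘ[P] Vec d) :
    Set (Proc P T d × Proc P T d) :=
  {YM | YM ∈ Sp P 𝓕 d p ×ˢ Mp0 P 𝓕 d p ∧
    ∀ t, YM.1 t + F YM.1 YM.2 t + YM.2 t = ξ + F YM.1 YM.2 ⊤ + YM.2 ⊤}

end BSE

end

/-! The correspondence itself is short algebra. By the forward equation, `Y^V + F + M^V` equals
`E_0(V)` at every time, and `M^V_T = E_0(V) - V`; so if `G(V) = V`, the right side `G(V) + M^V_T` of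
the BSE is `E_0(V)` as well. Conversely, since `F` and `M` start at 0, a solution satisfies `Y_0 = ξ
+ F_T + M_T`. Hence `Y` solves the forward equation started at `Y_0`, and `V = Y_0 - M_T` equals `ξ
+ F_T(Y,M)`. From `E_t(V) = Y_0 - M_t` one reads off `M^V = M` and `E_0(V) = Y_0`; uniqueness in (S)
gives `Y^V = Y`, so `G(V) = V`.

The weight of the proof lies in showing that these objects live in the stated spaces. Writing `V = η
x` gives `E_t(V) = η E[x | 𝓕_t]`, so `MV_mem_Mp0` needs an RCLL version of a closed martingale whose
supremum has finite `p`-norm (`exists_rcll_version`). It is obtained from right limits along dyadic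
times: Doob's maximal inequality controls the supremum, the upcrossing inequality rules out
oscillation, and the usual conditions make the limits adapted.

A second difficulty is additivity: a difference may be integrable on sets where its two terms are
not. Pulling a common `𝓕_0`-measurable factor out of both terms reduces to ordinary conditional
expectations (`isGenCondExpReal_mul_sub_mul`, `add_mem_LpMod`), which yields `E_t(Y_0 - M_T) = Y_0 -
M_t`. -/

namespace BSE

/-! ### Doob's `L^p` maximal inequality in discrete time. -/

section DoobMaximal

variable {Ω : Type*} [mΩ : MeasurableSpace Ω] {μ : Measure Ω}

/-- The running maximum of the positive part of the martingale closed by `y`. -/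
noncomputable def runningMax (μ : Measure Ω) (ℱ : Filtration ℕ mΩ) (y : Ω → ℝ) (N : ℕ) (ω : Ω) :
    ℝ :=
  (Finset.range (N + 1)).sup' Finset.nonempty_range_add_one fun k => (μ[y | ℱ k] ω)⁺

lemma measurable_runningMax (ℱ : Filtration ℕ mΩ) (y : Ω → ℝ) (N : ℕ) :
    Measurable (runningMax μ ℱ y N) := by
  unfold runningMax
  refine Finset.measurable_range_sup'' fun k _ => ?_
  exact ((stronglyMeasurable_condExp.mono (ℱ.le k)).measurable).sup_const 0

lemma runningMax_nonneg (ℱ : Filtration ℕ mΩ) (y : Ω → ℝ) (N : ℕ) (ω : Ω) :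
    0 ≤ runningMax μ ℱ y N ω :=
  (posPart_nonneg (μ[y | ℱ 0] ω)).trans
    (Finset.le_sup' (fun k => (μ[y | ℱ k] ω)⁺) (Finset.mem_range.2 (Nat.succ_pos N)))

/-- Doob's maximal inequality bounds `t μ(B)` by the integral of `y` over `B`. Splitting `y` at
height `t / 2` bounds this by `(t / 2) μ(B)` plus the integral over `{t < 2y}`, and the first term,
being finite, is absorbed on the left. The right side is a tail of `2y` under the measure `y μ`,
ready for the layer-cake formula. -/
lemma meas_lt_runningMax_mul_le [IsProbabilityMeasure μ] (ℱ : Filtration ℕ mΩ) {y : Ω → ℝ} (hy0 : 0 ≤ y)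
    (hy : Integrable y μ) {N : ℕ} (hym : StronglyMeasurable[ℱ N] y) {t : ℝ} (ht : 0 < t) :
    μ {ω | t < runningMax μ ℱ y N ω} * ENNReal.ofReal t ≤
      2 * (μ.withDensity fun ω => ENNReal.ofReal (y ω)) {ω | t < 2 * y ω} := by
  have hyM : Measurable y := (hym.mono (ℱ.le N)).measurable
  set B : Set Ω := {ω | t ≤ runningMax μ ℱ y N ω} with hB
  have hBm : MeasurableSet B := measurableSet_le measurable_const (measurable_runningMax ℱ y N)
  set E : Set Ω := {ω | t < 2 * y ω} with hE
  have hEm : MeasurableSet E := measurableSet_lt measurable_const (hyM.const_mul 2)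
  have hmax : ENNReal.ofReal t * μ B ≤ ∫⁻ ω in B, ENNReal.ofReal (y ω) ∂μ := by
    have h := maximal_ineq (martingale_condExp y ℱ μ).submartingale.pos
      (fun k ω => posPart_nonneg _) (ε := t.toNNReal) N
    rw [Real.coe_toNNReal t ht.le] at h
    refine h.trans (le_of_eq ?_)
    rw [← ofReal_integral_eq_lintegral_ofReal hy.integrableOn (ae_of_all _ hy0)]
    congr 1
    refine setIntegral_congr_fun hBm fun ω _ => ?_
    have : μ[y | ℱ N] = y := condExp_of_stronglyMeasurable (ℱ.le N) hym hy
    change (μ[y | ℱ N] ω)⁺ = y ω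
    rw [this]
    exact posPart_of_nonneg (hy0 ω)
  have hsplit : ∫⁻ ω in B, ENNReal.ofReal (y ω) ∂μ ≤ ENNReal.ofReal (t / 2) * μ B +
      (μ.withDensity fun ω => ENNReal.ofReal (y ω)) E := by
    rw [withDensity_apply _ hEm, ← lintegral_indicator hEm]
    calc ∫⁻ ω in B, ENNReal.ofReal (y ω) ∂μ
        ≤ ∫⁻ ω in B, (ENNReal.ofReal (t / 2) +
            E.indicator (fun ω => ENNReal.ofReal (y ω)) ω) ∂μ := by
          refine lintegral_mono fun ω => ?_
          by_cases h : ω ∈ E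
          · simp [h]
          · have : y ω ≤ t / 2 := by
              have : ¬ t < 2 * y ω := h
              linarith
            simpa [h] using ENNReal.ofReal_le_ofReal this
      _ = ENNReal.ofReal (t / 2) * μ B +
            ∫⁻ ω in B, E.indicator (fun ω => ENNReal.ofReal (y ω)) ω ∂μ := by
          rw [lintegral_add_left measurable_const, setLIntegral_const]
      _ ≤ _ := by
          exact add_le_add_right (setLIntegral_le_lintegral _ _) _
  have htwo : ENNReal.ofReal t = ENNReal.ofReal (t / 2) + ENNReal.ofReal (t / 2) := by
    rw [← ENNReal.ofReal_add (by positivity) (by positivity)]; congr 1; ring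
  have hhalf : ENNReal.ofReal (t / 2) * μ B ≤
      (μ.withDensity fun ω => ENNReal.ofReal (y ω)) E := by
    have h := hmax.trans hsplit
    rw [htwo, add_mul] at h
    exact (ENNReal.add_le_add_iff_left
      (ENNReal.mul_ne_top ENNReal.ofReal_ne_top (measure_ne_top μ B))).1 h
  calc μ {ω | t < runningMax μ ℱ y N ω} * ENNReal.ofReal t
      ≤ μ B * ENNReal.ofReal t := by
        refine mul_le_mul_left (measure_mono fun ω h => ?_) _
        exact le_of_lt (Set.mem_ofPred_eq ▸ h)
    _ = 2 * (ENNReal.ofReal (t / 2) * μ B) := by rw [htwo]; ring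
    _ ≤ _ := by gcongr

/-- The constant of Doob's `L^p` inequality (not optimal). -/
noncomputable def doobBound (μ : Measure Ω) (y : Ω → ℝ) (p : ℝ) : ℝ≥0∞ :=
  ENNReal.ofReal p * (2 * ((ENNReal.ofReal (p - 1))⁻¹ *
    ∫⁻ ω, ENNReal.ofReal ((2 * y ω) ^ (p - 1)) ∂(μ.withDensity fun ω => ENNReal.ofReal (y ω))))

/-- The layer-cake formula is used twice: for the running maximum under `μ` with exponent `p`, and
for `2y` under `y μ` with exponent `p - 1`. The two integrands in `t` are then compared by the
weak-type bound; the factor `(p - 1)⁻¹` in `doobBound` cancels the constant of the second formula.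
-/
lemma lintegral_runningMax_rpow_le [IsProbabilityMeasure μ] (ℱ : Filtration ℕ mΩ) {y : Ω → ℝ} (hy0 : 0 ≤ y)
    (hy : Integrable y μ) {N : ℕ} (hym : StronglyMeasurable[ℱ N] y) {p : ℝ} (hp : 1 < p) :
    ∫⁻ ω, ENNReal.ofReal (runningMax μ ℱ y N ω ^ p) ∂μ ≤ doobBound μ y p := by
  have hyM : Measurable y := (hym.mono (ℱ.le N)).measurable
  rw [lintegral_rpow_eq_lintegral_meas_lt_mul μ (ae_of_all _ (runningMax_nonneg ℱ y N))
    (measurable_runningMax ℱ y N).aemeasurable (by linarith : 0 < p)]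
  unfold doobBound
  rw [lintegral_rpow_eq_lintegral_meas_lt_mul _
    (ae_of_all _ fun ω => mul_nonneg zero_le_two (hy0 ω)) (hyM.const_mul 2).aemeasurable
    (by linarith : 0 < p - 1), ← mul_assoc (ENNReal.ofReal (p - 1))⁻¹,
    ENNReal.inv_mul_cancel (by simpa using hp) ENNReal.ofReal_ne_top, one_mul,
    ← lintegral_const_mul' 2 _ (by simp)]
  gcongr ENNReal.ofReal p * ?_
  refine setLIntegral_mono' measurableSet_Ioi fun t ht => ?_
  have ht : 0 < t := ht
  have hpow : ENNReal.ofReal (t ^ (p - 1)) =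
      ENNReal.ofReal t * ENNReal.ofReal (t ^ (p - 1 - 1)) := by
    rw [← ENNReal.ofReal_mul ht.le]
    congr 1
    rw [Real.rpow_sub_one ht.ne' (p - 1)]
    field_simp
  rw [hpow, ← mul_assoc, ← mul_assoc]
  exact mul_le_mul_left (meas_lt_runningMax_mul_le ℱ hy0 hy hym ht) _

/-- Against the density `y`, the integrand `(2y)^(p-1)` becomes a constant times `y^p`. -/
lemma doobBound_lt_top {y : Ω → ℝ} (hy0 : 0 ≤ y) (hyM : Measurable y) {p : ℝ} (hp : 1 < p)
    (hy : ∫⁻ ω, ENNReal.ofReal (y ω) ^ p ∂μ < ∞) : doobBound μ y p < ∞ := by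
  unfold doobBound
  rw [lintegral_withDensity_eq_lintegral_mul _ hyM.ennreal_ofReal
    ((hyM.const_mul 2).pow_const _).ennreal_ofReal]
  have heq : ∀ ω, ((fun ω => ENNReal.ofReal (y ω)) *
      fun ω => ENNReal.ofReal ((2 * y ω) ^ (p - 1))) ω =
      ENNReal.ofReal (2 ^ (p - 1)) * ENNReal.ofReal (y ω) ^ p := by
    intro ω
    rw [Pi.mul_apply, ENNReal.ofReal_rpow_of_nonneg (hy0 ω) (by linarith),
      ← ENNReal.ofReal_mul (hy0 ω), ← ENNReal.ofReal_mul (by positivity)]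
    congr 1
    rw [Real.mul_rpow zero_le_two (hy0 ω)]
    have : y ω ^ p = y ω * y ω ^ (p - 1) := by
      conv_lhs => rw [show p = 1 + (p - 1) by ring]
      rw [Real.rpow_add' (hy0 ω) (by linarith), Real.rpow_one]
    rw [this]; ring
  simp_rw [heq]
  rw [lintegral_const_mul' _ _ ENNReal.ofReal_ne_top]
  refine ENNReal.mul_lt_top ENNReal.ofReal_lt_top (ENNReal.mul_lt_top (by simp)
    (ENNReal.mul_lt_top ?_ (ENNReal.mul_lt_top ENNReal.ofReal_lt_top hy)))
  simpa using hp

end DoobMaximal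

/-! ### Dyadic times in `[0,T]`. -/

section Grid

variable {T : ℝ≥0}

/-- The `k`-th point of the `n`-th dyadic grid of `[0,T]`, equal to `T` for `k ≥ 2 ^ n`. -/
noncomputable def grid (T : ℝ≥0) (n k : ℕ) : Time T := ⟨min (T * (k / 2 ^ n)) T, Set.mem_Iic.2 (min_le_right _ _)⟩

lemma grid_mono (n : ℕ) : Monotone (grid T n) := fun i j h => by
  change min (T * (i / 2 ^ n)) T ≤ min (T * (j / 2 ^ n)) T
  gcongr

lemma grid_eq_top {n k : ℕ} (h : 2 ^ n ≤ k) : grid T n k = ⊤ := by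
  refine Subtype.ext ?_
  change min (T * (k / 2 ^ n)) T = T
  refine min_eq_right (le_mul_of_one_le_right zero_le ?_)
  rw [one_le_div (by positivity)]
  exact_mod_cast h

/-- The grids are nested; this makes grid maxima increase with `n` and places any finite set of
dyadic times in all sufficiently fine grids. -/
lemma grid_refine (n j k : ℕ) : grid T (n + j) (2 ^ j * k) = grid T n k := by
  refine Subtype.ext ?_
  change min (T * (((2 ^ j * k : ℕ) : ℝ≥0) / 2 ^ (n + j))) T = min (T * (k / 2 ^ n)) T
  congr 2
  push_cast
  rw [pow_add]
  field_simp

/-- The dyadic points of `[0,T]`. -/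
def dyadic (T : ℝ≥0) : Set (Time T) := {t | ∃ n k, k ≤ 2 ^ n ∧ grid T n k = t}

lemma dyadic_countable : (dyadic T).Countable :=
  by
  refine (Set.countable_range fun q : ℕ × ℕ => grid T q.1 q.2).mono ?_
  rintro _ ⟨n, k, _, rfl⟩
  exact Set.mem_range_self (n, k)

lemma top_mem_dyadic : (⊤ : Time T) ∈ dyadic T := ⟨0, 1, by simp, grid_eq_top (by simp)⟩

lemma grid_mem_dyadic (n k : ℕ) : grid T n k ∈ dyadic T := by
  by_cases h : k ≤ 2 ^ n
  · exact ⟨n, k, h, rfl⟩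
  · rw [grid_eq_top (by omega)]; exact top_mem_dyadic

lemma exists_grid_index {t : Time T} (ht : t ∈ dyadic T) :
    ∃ n₀, ∀ n ≥ n₀, ∃ k ≤ 2 ^ n, grid T n k = t := by
  obtain ⟨n₀, k, hk, rfl⟩ := ht
  refine ⟨n₀, fun n hn => ?_⟩
  obtain ⟨j, rfl⟩ := Nat.exists_eq_add_of_le hn
  refine ⟨2 ^ j * k, ?_, grid_refine n₀ j k⟩
  rw [pow_add, mul_comm]
  gcongr

lemma exists_dyadic_btwn {s u : Time T} (h : s < u) : ∃ t ∈ dyadic T, s < t ∧ t < u := by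
  have hsu : ((s : ℝ≥0) : ℝ) < ((u : ℝ≥0) : ℝ) := by exact_mod_cast h
  have huT : ((u : ℝ≥0) : ℝ) ≤ T := by exact_mod_cast u.2
  have hs0 : (0 : ℝ) ≤ ((s : ℝ≥0) : ℝ) := NNReal.coe_nonneg _
  have hT : (0 : ℝ) < T := by linarith
  obtain ⟨n, hn⟩ := pow_unbounded_of_one_lt (T / (((u : ℝ≥0) : ℝ) - ((s : ℝ≥0) : ℝ)))
    (one_lt_two : (1 : ℝ) < 2)
  have h2 : (0 : ℝ) < 2 ^ n := by positivity
  rw [div_lt_iff₀ (by linarith)] at hn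
  -- The index of the first grid point strictly after `s`; it stays before `u` because the mesh `T /
  -- 2 ^ n` is smaller than `u - s`.
  set k : ℕ := ⌊((s : ℝ≥0) : ℝ) * 2 ^ n / T⌋₊ + 1 with hk
  have hk1 : ((s : ℝ≥0) : ℝ) * 2 ^ n / T < k := by
    rw [hk]; push_cast; exact Nat.lt_floor_add_one _
  have hk2 : (k : ℝ) ≤ ((s : ℝ≥0) : ℝ) * 2 ^ n / T + 1 := by
    rw [hk]; push_cast; gcongr; exact Nat.floor_le (by positivity)
  rw [div_lt_iff₀ hT] at hk1
  have hk3 : (k : ℝ) * T ≤ ((s : ℝ≥0) : ℝ) * 2 ^ n + T := by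
    have := mul_le_mul_of_nonneg_right hk2 hT.le
    rwa [add_mul, div_mul_cancel₀ _ hT.ne', one_mul] at this
  have hval : ((s : ℝ≥0) : ℝ) < (T : ℝ) * (k / 2 ^ n) ∧
      (T : ℝ) * (k / 2 ^ n) < ((u : ℝ≥0) : ℝ) := by
    rw [← mul_div_assoc, lt_div_iff₀ h2, div_lt_iff₀ h2]
    constructor <;> nlinarith
  have hcoe : (((grid T n k : Time T) : ℝ≥0) : ℝ) = (T : ℝ) * (k / 2 ^ n) := by
    change ((min (T * (k / 2 ^ n)) T : ℝ≥0) : ℝ) = _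
    push_cast
    exact min_eq_left (by linarith [hval.2])
  refine ⟨grid T n k, grid_mem_dyadic n k, ?_, ?_⟩
  · have : ((s : ℝ≥0) : ℝ) < (((grid T n k : Time T) : ℝ≥0) : ℝ) := by rw [hcoe]; exact hval.1
    exact_mod_cast this
  · have : (((grid T n k : Time T) : ℝ≥0) : ℝ) < ((u : ℝ≥0) : ℝ) := by rw [hcoe]; exact hval.2
    exact_mod_cast this

end Grid

/-! ### One-sided limits of paths from upcrossing counts. -/

section Paths

variable {T : ℝ≥0}

lemma eventually_dyadic_right {t : Time T} (ht : t < ⊤) {q : Time T → Prop} :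
    (∀ᶠ s in 𝓝[dyadic T ∩ Set.Ioi t] t, q s) ↔
      ∃ u, t < u ∧ ∀ s ∈ dyadic T, t < s → s < u → q s := by
  rw [Set.inter_comm, nhdsWithin_inter', eventually_inf_principal]
  change _ ∈ 𝓝[>] t ↔ _
  rw [mem_nhdsGT_iff_exists_Ioo_subset' ht]
  exact ⟨fun ⟨u, hu, h⟩ => ⟨u, hu, fun s hs h1 h2 => h ⟨h1, h2⟩ hs⟩,
    fun ⟨u, hu, h⟩ => ⟨u, hu, fun s hs hd => h s hd hs.1 hs.2⟩⟩

lemma eventually_dyadic_left {t : Time T} (ht : ⊥ < t) {q : Time T → Prop} :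
    (∀ᶠ s in 𝓝[dyadic T ∩ Set.Iio t] t, q s) ↔
      ∃ u, u < t ∧ ∀ s ∈ dyadic T, u < s → s < t → q s := by
  rw [Set.inter_comm, nhdsWithin_inter', eventually_inf_principal]
  change _ ∈ 𝓝[<] t ↔ _
  rw [mem_nhdsLT_iff_exists_Ioo_subset' ht]
  exact ⟨fun ⟨u, hu, h⟩ => ⟨u, hu, fun s hs h1 h2 => h ⟨h1, h2⟩ hs⟩,
    fun ⟨u, hu, h⟩ => ⟨u, hu, fun s hs hd => h s hd hs.1 hs.2⟩⟩

lemma neBot_dyadic_right {t : Time T} (ht : t < ⊤) : (𝓝[dyadic T ∩ Set.Ioi t] t).NeBot := by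
  rw [neBot_iff]
  intro h
  have : ∀ᶠ s in 𝓝[dyadic T ∩ Set.Ioi t] t, False := by rw [h]; exact eventually_bot
  rw [eventually_dyadic_right ht] at this
  obtain ⟨u, hu, h⟩ := this
  obtain ⟨s, hs, h1, h2⟩ := exists_dyadic_btwn hu
  exact h s hs h1 h2

lemma le_of_tendsto_dyadic_right {t u : Time T} (htu : t < u) {h : Time T → ℝ} {l c ε : ℝ}
    (hl : Tendsto h (𝓝[dyadic T ∩ Set.Ioi t] t) (𝓝 l))
    (hb : ∀ s ∈ dyadic T, t < s → s < u → dist (h s) c ≤ ε) : dist l c ≤ ε := by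
  have ht : t < ⊤ := htu.trans_le le_top
  have := neBot_dyadic_right ht
  refine le_of_tendsto (hl.dist tendsto_const_nhds) ?_
  rw [eventually_dyadic_right ht]
  exact ⟨u, htu, hb⟩

/-- The right limits along the dyadic points form a right-continuous path with left limits. -/
lemma rcll_of_dyadic_limits {h X : Time T → ℝ}
    (hr : ∀ t < ⊤, Tendsto h (𝓝[dyadic T ∩ Set.Ioi t] t) (𝓝 (X t)))
    (hl : ∀ t, ∃ l, Tendsto h (𝓝[dyadic T ∩ Set.Iio t] t) (𝓝 l)) (t : Time T) :
    ContinuousWithinAt X (Set.Ioi t) t ∧ ∃ l, Tendsto X (𝓝[<] t) (𝓝 l) := by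
  constructor
  · rcases eq_or_lt_of_le (le_top : t ≤ ⊤) with rfl | ht
    · simp [ContinuousWithinAt]
    · refine Metric.tendsto_nhds.2 fun ε hε => ?_
      have h1 := Metric.tendsto_nhds.1 (hr t ht) (ε / 2) (by positivity)
      rw [eventually_dyadic_right ht] at h1
      obtain ⟨u, hu, h1⟩ := h1
      filter_upwards [Ioo_mem_nhdsGT hu] with s hs
      refine (le_of_tendsto_dyadic_right hs.2 (hr s (hs.2.trans_le le_top))
        fun v hv h2 h3 => (h1 v hv (hs.1.trans h2) h3).le).trans_lt (by linarith)
  · rcases eq_or_lt_of_le (bot_le : ⊥ ≤ t) with rfl | ht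
    · exact ⟨0, by simp⟩
    · obtain ⟨l, hl⟩ := hl t
      refine ⟨l, Metric.tendsto_nhds.2 fun ε hε => ?_⟩
      have h1 := Metric.tendsto_nhds.1 hl (ε / 2) (by positivity)
      rw [eventually_dyadic_left ht] at h1
      obtain ⟨u, hu, h1⟩ := h1
      filter_upwards [Ioo_mem_nhdsLT hu] with s hs
      refine (le_of_tendsto_dyadic_right hs.2 (hr s (hs.2.trans_le le_top))
        fun v hv h2 h3 => (h1 v hv (hs.1.trans h2) h3).le).trans_lt (by linarith)

/-- `Oscillates h a b K r s`: along the dyadic points of `[r,s]` the path `h` goes `K` times from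
below `a` to above `b`. -/
def Oscillates (h : Time T → ℝ) (a b : ℝ) : ℕ → Time T → Time T → Prop
  | 0, r, s => r ≤ s
  | K + 1, r, s => ∃ w u v, Oscillates h a b K r w ∧ w < u ∧ u < v ∧ v ≤ s ∧
      u ∈ dyadic T ∧ v ∈ dyadic T ∧ h u < a ∧ b < h v

/-- The recursion in `Oscillates` appends crossings at the late end. Near a right limit they
accumulate downwards to `t`, so a new one must be put in front. -/
lemma Oscillates.cons {h : Time T → ℝ} {a b : ℝ} {r u v r' : Time T} (hru : r < u) (huv : u < v)
    (hvr : v < r') (hu : u ∈ dyadic T) (hv : v ∈ dyadic T) (ha : h u < a) (hb : b < h v) :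
    ∀ {K : ℕ} {s : Time T}, Oscillates h a b K r' s → Oscillates h a b (K + 1) r s
  | 0, _, hs => ⟨r, u, v, le_refl r, hru, huv, hvr.le.trans hs, hu, hv, ha, hb⟩
  | _ + 1, _, ⟨w, u', v', hw, h1⟩ => ⟨w, u', v', Oscillates.cons hru huv hvr hu hv ha hb hw, h1⟩

lemma oscillates_right {h : Time T → ℝ} {a b : ℝ} {t : Time T} (ht : t < ⊤)
    (ha : ∃ᶠ s in 𝓝[dyadic T ∩ Set.Ioi t] t, h s < a)
    (hb : ∃ᶠ s in 𝓝[dyadic T ∩ Set.Ioi t] t, b < h s) (K : ℕ) :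
    ∀ u, t < u → ∃ r, t < r ∧ Oscillates h a b K r u := by
  have key : ∀ {q : Time T → Prop}, (∃ᶠ s in 𝓝[dyadic T ∩ Set.Ioi t] t, q s) →
      ∀ u, t < u → ∃ s ∈ dyadic T, t < s ∧ s < u ∧ q s := by
    intro q hq u hu
    by_contra! hcon
    exact hq ((eventually_dyadic_right ht).2 ⟨u, hu, hcon⟩)
  induction K with
  | zero => exact fun u hu => ⟨u, hu, le_refl u⟩
  | succ K ih =>
    intro u hu
    obtain ⟨r', hr', hosc⟩ := ih u hu
    obtain ⟨v, hv, htv, hvr, hbv⟩ := key hb r' hr'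
    obtain ⟨w, hw, htw, hwv, haw⟩ := key ha v htv
    obtain ⟨r, hr1, hr2⟩ := exists_between htw
    exact ⟨r, hr1, hosc.cons hr2 hwv hvr hw hv haw hbv⟩

lemma oscillates_left {h : Time T → ℝ} {a b : ℝ} {t : Time T} (ht : ⊥ < t)
    (ha : ∃ᶠ s in 𝓝[dyadic T ∩ Set.Iio t] t, h s < a)
    (hb : ∃ᶠ s in 𝓝[dyadic T ∩ Set.Iio t] t, b < h s) (K : ℕ) :
    ∃ s, s < t ∧ Oscillates h a b K ⊥ s := by
  have key : ∀ {q : Time T → Prop}, (∃ᶠ s in 𝓝[dyadic T ∩ Set.Iio t] t, q s) →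
      ∀ u, u < t → ∃ s ∈ dyadic T, u < s ∧ s < t ∧ q s := by
    intro q hq u hu
    by_contra! hcon
    exact hq ((eventually_dyadic_left ht).2 ⟨u, hu, hcon⟩)
  induction K with
  | zero => exact ⟨⊥, ht, le_refl _⟩
  | succ K ih =>
    obtain ⟨s, hs, hosc⟩ := ih
    obtain ⟨u, hu, hsu, hut, hau⟩ := key ha s hs
    obtain ⟨v, hv, huv, hvt, hbv⟩ := key hb u hut
    exact ⟨v, hvt, s, u, v, hosc, hsu, huv, le_rfl, hu, hv, hau, hbv⟩

/-- The number of upcrossings of `[a,b]` along the `n`-th dyadic grid. -/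
noncomputable def gridUpcrossings {Ω : Type*} (f : Time T → Ω → ℝ) (a b : ℝ) (n : ℕ) (ω : Ω) : ℕ :=
  upcrossingsBefore a b (fun k => f (grid T n k)) (2 ^ n + 1) ω

/-- An oscillation involves finitely many dyadic times, and all of them lie on every sufficiently
fine grid. -/
lemma le_gridUpcrossings_of_oscillates {Ω : Type*} {f : Time T → Ω → ℝ} {ω : Ω} {a b : ℝ}
    (hab : a < b) {K : ℕ} {r s : Time T} (hosc : Oscillates (fun t => f t ω) a b K r s) :
    ∃ n₀, ∀ n ≥ n₀, K ≤ gridUpcrossings f a b n ω := by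
  -- The horizon `N` is left free so that the induction can count the earlier crossings before the
  -- index of `u` and then add the crossing from `u` to `v`.
  suffices H : ∀ K s, Oscillates (fun t => f t ω) a b K r s → ∃ n₀, ∀ n ≥ n₀, ∀ N,
      (∀ k ≤ 2 ^ n, grid T n k ≤ s → k < N) →
      K ≤ upcrossingsBefore a b (fun k => f (grid T n k)) N ω by
    obtain ⟨n₀, h⟩ := H K s hosc
    exact ⟨n₀, fun n hn => h n hn _ fun k hk _ => Nat.lt_succ_of_le hk⟩
  intro K
  induction K with
  | zero => exact fun _ _ => ⟨0, fun _ _ _ _ => Nat.zero_le _⟩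
  | succ K ih =>
    rintro s ⟨w, u, v, hw, hwu, huv, hvs, hu, hv, hau, hbv⟩
    obtain ⟨n₁, h₁⟩ := ih w hw
    obtain ⟨n₂, h₂⟩ := exists_grid_index hu
    obtain ⟨n₃, h₃⟩ := exists_grid_index hv
    refine ⟨max n₁ (max n₂ n₃), fun n hn N hN => ?_⟩
    obtain ⟨i, hi, rfl⟩ := h₂ n (by omega)
    obtain ⟨j, hj, rfl⟩ := h₃ n (by omega)
    have hij : i ≤ j := by
      by_contra! hlt
      exact absurd huv (not_lt.2 (grid_mono n hlt.le))
    have hK := h₁ n (by omega) i fun k _ hk => by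
      by_contra! hlt
      exact absurd (hwu.trans_le (grid_mono n hlt)) (not_lt.2 hk)
    have hlt := upcrossingsBefore_lt_of_exists_upcrossing (f := fun k => f (grid T n k))
      (ω := ω) hab le_rfl hau hij hbv
    have hmono := upcrossingsBefore_mono (f := fun k => f (grid T n k)) hab
      (Nat.succ_le_of_lt (hN j hj hvs)) ω
    simp only [Nat.succ_eq_add_one] at hmono
    omega

/-- A path whose numbers of upcrossings along the dyadic grids do not tend to infinity, and that
is bounded on the dyadic points, has one-sided limits along the dyadic points. -/
lemma exists_dyadic_limits {Ω : Type*} {f : Time T → Ω → ℝ} {ω : Ω} {C : ℝ}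
    (hC : ∀ s ∈ dyadic T, |f s ω| ≤ C)
    (hU : ∀ a b : ℚ, a < b → ∃ K, ∀ n₀, ∃ n ≥ n₀, gridUpcrossings f a b n ω < K) (t : Time T) :
    (∃ l, Tendsto (fun s => f s ω) (𝓝[dyadic T ∩ Set.Ioi t] t) (𝓝 l)) ∧
    ∃ l, Tendsto (fun s => f s ω) (𝓝[dyadic T ∩ Set.Iio t] t) (𝓝 l) := by
  have hosc : ∀ a b : ℚ, a < b → ¬ ∀ K, ∃ r s, Oscillates (fun t => f t ω) a b K r s := by
    intro a b hab hall
    obtain ⟨K, hK⟩ := hU a b hab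
    obtain ⟨r, s, hrs⟩ := hall K
    obtain ⟨n₀, hn₀⟩ := le_gridUpcrossings_of_oscillates (by exact_mod_cast hab) hrs
    obtain ⟨n, hn, hlt⟩ := hK n₀
    exact absurd hlt (not_lt.2 (hn₀ n hn))
  have hbdd : ∀ A : Set (Time T), ∀ᶠ s in 𝓝[dyadic T ∩ A] t, |f s ω| ≤ C := fun A =>
    eventually_nhdsWithin_of_forall fun s hs => hC s hs.1
  constructor
  · rcases eq_or_lt_of_le (le_top : t ≤ ⊤) with rfl | ht
    · exact ⟨0, by simp⟩
    · refine tendsto_of_no_upcrossings Rat.isDenseEmbedding_coe_real.dense ?_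
        ⟨C, by simpa using (hbdd _).mono fun s hs => (abs_le.1 hs).2⟩
        ⟨-C, by simpa using (hbdd _).mono fun s hs => (abs_le.1 hs).1⟩
      rintro _ ⟨a, rfl⟩ _ ⟨b, rfl⟩ hab ⟨h1, h2⟩
      refine hosc a b (by exact_mod_cast hab) fun K => ?_
      obtain ⟨r, _, h⟩ := oscillates_right ht h1 h2 K ⊤ ht
      exact ⟨r, ⊤, h⟩
  · rcases eq_or_lt_of_le (bot_le : ⊥ ≤ t) with rfl | ht
    · exact ⟨0, by simp⟩
    · refine tendsto_of_no_upcrossings Rat.isDenseEmbedding_coe_real.dense ?_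
        ⟨C, by simpa using (hbdd _).mono fun s hs => (abs_le.1 hs).2⟩
        ⟨-C, by simpa using (hbdd _).mono fun s hs => (abs_le.1 hs).1⟩
      rintro _ ⟨a, rfl⟩ _ ⟨b, rfl⟩ hab ⟨h1, h2⟩
      refine hosc a b (by exact_mod_cast hab) fun K => ?_
      obtain ⟨s, _, h⟩ := oscillates_left ht h1 h2 K
      exact ⟨⊥, s, h⟩

end Paths

end BSE

namespace BSE

/-! ### RCLL versions of closed martingales. -/

section ClosedMartingale

variable {Ω : Type*} [mΩ : MeasurableSpace Ω] {T : ℝ≥0} {P : Measure Ω}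

/-- The filtration along the `n`-th dyadic grid. -/
noncomputable def gridFiltration (𝓕 : Filtration (Time T) mΩ) (n : ℕ) : Filtration ℕ mΩ where
  seq k := 𝓕 (grid T n k)
  mono' _ _ h := 𝓕.mono (grid_mono n h)
  le' _ := 𝓕.le _

/-- The supremum over the dyadic times of the positive part of the martingale closed by `y`. -/
noncomputable def dyadicSup (P : Measure Ω) (𝓕 : Filtration (Time T) mΩ) (y : Ω → ℝ) (ω : Ω) :
    ℝ≥0∞ :=
  ⨆ n, ENNReal.ofReal (runningMax P (gridFiltration 𝓕 n) y (2 ^ n) ω)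

lemma measurable_dyadicSup (𝓕 : Filtration (Time T) mΩ) (y : Ω → ℝ) :
    Measurable (dyadicSup P 𝓕 y) :=
  Measurable.iSup fun _ => (measurable_runningMax _ _ _).ennreal_ofReal

lemma runningMax_grid_mono (𝓕 : Filtration (Time T) mΩ) (y : Ω → ℝ) (ω : Ω) :
    Monotone fun n => runningMax P (gridFiltration 𝓕 n) y (2 ^ n) ω := by
  refine monotone_nat_of_le_succ fun n => Finset.sup'_le _ _ fun k hk => ?_
  have hk : k < 2 ^ n + 1 := Finset.mem_range.1 hk
  have h := Finset.le_sup' (s := Finset.range (2 ^ (n + 1) + 1))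
    (fun k => (P[y | gridFiltration 𝓕 (n + 1) k] ω)⁺) (b := 2 ^ 1 * k)
    (Finset.mem_range.2 (by rw [pow_succ 2 n]; omega))
  refine le_trans (le_of_eq ?_) h
  change (P[y | 𝓕 (grid T n k)] ω)⁺ = (P[y | 𝓕 (grid T (n + 1) (2 ^ 1 * k))] ω)⁺
  rw [grid_refine]

lemma ofReal_condExp_le_dyadicSup (𝓕 : Filtration (Time T) mΩ) (y : Ω → ℝ) {t : Time T}
    (ht : t ∈ dyadic T) (ω : Ω) : ENNReal.ofReal (P[y | 𝓕 t] ω) ≤ dyadicSup P 𝓕 y ω := by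
  obtain ⟨n, k, hk, rfl⟩ := ht
  refine le_trans (ENNReal.ofReal_le_ofReal ?_) (le_iSup
    (fun n => ENNReal.ofReal (runningMax P (gridFiltration 𝓕 n) y (2 ^ n) ω)) n)
  exact (le_posPart _).trans (Finset.le_sup' (fun k => (P[y | gridFiltration 𝓕 n k] ω)⁺)
    (Finset.mem_range.2 (Nat.lt_succ_of_le hk)))

lemma lintegral_dyadicSup_rpow_le [IsProbabilityMeasure P] (𝓕 : Filtration (Time T) mΩ)
    {y : Ω → ℝ} (hy0 : 0 ≤ y) (hy : Integrable y P) (hym : StronglyMeasurable[𝓕 ⊤] y) {p : ℝ}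
    (hp : 1 < p) : ∫⁻ ω, dyadicSup P 𝓕 y ω ^ p ∂P ≤ doobBound P y p := by
  have hp0 : 0 < p := by linarith
  have heq : ∀ ω, dyadicSup P 𝓕 y ω ^ p =
      ⨆ n, ENNReal.ofReal (runningMax P (gridFiltration 𝓕 n) y (2 ^ n) ω ^ p) := fun ω => by
    have := (ENNReal.orderIsoRpow p hp0).map_iSup
      fun n => ENNReal.ofReal (runningMax P (gridFiltration 𝓕 n) y (2 ^ n) ω)
    simp only [ENNReal.orderIsoRpow_apply] at this
    rw [dyadicSup, this]
    exact iSup_congr fun n => ENNReal.ofReal_rpow_of_nonneg (runningMax_nonneg _ _ _ _) hp0.le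
  simp_rw [heq]
  rw [lintegral_iSup (fun n => ((measurable_runningMax _ _ _).pow_const _).ennreal_ofReal)]
  · refine iSup_le fun n => lintegral_runningMax_rpow_le _ hy0 hy ?_ hp
    change StronglyMeasurable[𝓕 (grid T n (2 ^ n))] y
    rwa [grid_eq_top le_rfl]
  · intro i j hij ω
    exact ENNReal.ofReal_le_ofReal (Real.rpow_le_rpow (runningMax_nonneg _ _ _ _)
      (runningMax_grid_mono 𝓕 y ω hij) hp0.le)

lemma dyadicSup_le_of_bounded (𝓕 : Filtration (Time T) mΩ)
    {y : Ω → ℝ} {C : ℝ} (hC : 0 ≤ C) (hy : ∀ᵐ ω ∂P, ‖y ω‖ ≤ C) :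
    ∀ᵐ ω ∂P, dyadicSup P 𝓕 y ω ≤ ENNReal.ofReal C := by
  have : ∀ᵐ ω ∂P, ∀ n k, ‖P[y | 𝓕 (grid T n k)] ω‖ ≤ C :=
    ae_all_iff.2 fun n => ae_all_iff.2 fun k => ae_bdd_norm_condExp_of_ae_bdd_norm hy
  filter_upwards [this] with ω hω
  refine iSup_le fun n => ENNReal.ofReal_le_ofReal (Finset.sup'_le _ _ fun k _ => ?_)
  exact sup_le ((le_abs_self _).trans (hω n k)) hC

/-- The upcrossing inequality bounds the expected counts uniformly in `n`, so by Fatou their liminf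
is a.s. finite. -/
lemma ae_gridUpcrossings_not_tendsto [IsProbabilityMeasure P] (𝓕 : Filtration (Time T) mΩ)
    (x : Ω → ℝ) {a b : ℝ} (hab : a < b) :
    ∀ᵐ ω ∂P, ∃ K, ∀ n₀, ∃ n ≥ n₀, gridUpcrossings (fun t => P[x | 𝓕 t]) a b n ω < K := by
  set U : ℕ → Ω → ℕ := gridUpcrossings (fun t => P[x | 𝓕 t]) a b with hU
  have hmart : ∀ n, Submartingale (fun k => P[x | 𝓕 (grid T n k)]) (gridFiltration 𝓕 n) P :=
    fun n => (martingale_condExp x (gridFiltration 𝓕 n) P).submartingale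
  have hUm : ∀ n, Measurable (U n) := fun n => (hmart n).1.measurable_upcrossingsBefore hab
  set C : ℝ := ∫ ω, (P[x | 𝓕 ⊤] ω - a)⁺ ∂P with hC
  have hbound : ∀ n, ∫⁻ ω, (U n ω : ℝ≥0∞) ∂P ≤ ENNReal.ofReal (C / (b - a)) := fun n => by
    have h1 := (hmart n).mul_integral_upcrossingsBefore_le_integral_pos_part a b (2 ^ n + 1)
    -- The horizon index `2 ^ n + 1` lies past the end of the grid, hence stands for the time `T`;
    -- this makes the bound independent of `n`.
    rw [grid_eq_top (Nat.le_succ _)] at h1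
    have hint : Integrable (fun ω => (U n ω : ℝ)) P :=
      (hmart n).1.integrable_upcrossingsBefore hab
    have h2 := ofReal_integral_eq_lintegral_ofReal hint (ae_of_all _ fun ω => Nat.cast_nonneg _)
    simp only [ENNReal.ofReal_natCast] at h2
    rw [← h2]
    refine ENNReal.ofReal_le_ofReal ?_
    rw [le_div_iff₀ (by linarith), mul_comm]
    exact h1
  have hlim : ∫⁻ ω, liminf (fun n => (U n ω : ℝ≥0∞)) atTop ∂P < ∞ := by
    refine (lintegral_liminf_le fun n => measurable_from_top.comp (hUm n)).trans_lt ?_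
    refine (liminf_le_of_frequently_le' (Frequently.of_forall hbound)).trans_lt
      ENNReal.ofReal_lt_top
  have hmeas : Measurable fun ω => liminf (fun n => (U n ω : ℝ≥0∞)) atTop :=
    Measurable.liminf fun n => measurable_from_top.comp (hUm n)
  filter_upwards [ae_lt_top hmeas hlim.ne] with ω hω
  obtain ⟨K, hK⟩ := ENNReal.exists_nat_gt hω.ne
  refine ⟨K, fun n₀ => ?_⟩
  obtain ⟨n, hn, h⟩ := frequently_atTop.1 (frequently_lt_of_liminf_lt (by isBoundedDefault) hK) n₀
  exact ⟨n, hn, by exact_mod_cast h⟩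

/-- The right limits along the dyadic times of the martingale closed by `x`, on a set `E`. -/
noncomputable def rightLimit (P : Measure Ω) (𝓕 : Filtration (Time T) mΩ) (x : Ω → ℝ) (E : Set Ω)
    (t : Time T) (ω : Ω) : ℝ :=
  open scoped Classical in
  if ω ∈ E then
    if t = ⊤ then P[x | 𝓕 ⊤] ω
    else limUnder (𝓝[dyadic T ∩ Set.Ioi t] t) fun s => P[x | 𝓕 s] ω
  else 0

/-- The paths at which the martingale closed by `x` has one-sided limits along the dyadic times
and is dominated there by `dyadicSup`. -/
def regularPaths (P : Measure Ω) (𝓕 : Filtration (Time T) mΩ) (x : Ω → ℝ) : Set Ω :=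
  {ω | (∀ t, (∃ l, Tendsto (fun s => P[x | 𝓕 s] ω) (𝓝[dyadic T ∩ Set.Ioi t] t) (𝓝 l)) ∧
      ∃ l, Tendsto (fun s => P[x | 𝓕 s] ω) (𝓝[dyadic T ∩ Set.Iio t] t) (𝓝 l)) ∧
    ∀ s ∈ dyadic T, ‖P[x | 𝓕 s] ω‖ₑ ≤ dyadicSup P 𝓕 (fun ω => ‖x ω‖) ω}

lemma ae_mem_regularPaths [IsProbabilityMeasure P] (𝓕 : Filtration (Time T) mΩ) {x : Ω → ℝ}
    (hS : ∀ᵐ ω ∂P, dyadicSup P 𝓕 (fun ω => ‖x ω‖) ω < ∞) :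
    ∀ᵐ ω ∂P, ω ∈ regularPaths P 𝓕 x := by
  have hdom : ∀ᵐ ω ∂P, ∀ s ∈ dyadic T,
      ‖P[x | 𝓕 s] ω‖ₑ ≤ dyadicSup P 𝓕 (fun ω => ‖x ω‖) ω := by
    rw [ae_ball_iff dyadic_countable]
    intro s hs
    filter_upwards [norm_condExp_le (m := 𝓕 s) (μ := P) x] with ω hω
    refine le_trans ?_ (ofReal_condExp_le_dyadicSup 𝓕 _ hs ω)
    rw [← ofReal_norm]
    exact ENNReal.ofReal_le_ofReal hω
  have hU : ∀ᵐ ω ∂P, ∀ a b : ℚ, a < b →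
      ∃ K, ∀ n₀, ∃ n ≥ n₀, gridUpcrossings (fun t => P[x | 𝓕 t]) a b n ω < K := by
    refine ae_all_iff.2 fun a => ae_all_iff.2 fun b => ?_
    by_cases hab : a < b
    · filter_upwards [ae_gridUpcrossings_not_tendsto 𝓕 x
        (show (a : ℝ) < b by exact_mod_cast hab)] with ω hω _ using hω
    · exact ae_of_all _ fun _ h => absurd h hab
  filter_upwards [hS, hdom, hU] with ω h1 h2 h3
  refine ⟨fun t => exists_dyadic_limits (f := fun t => P[x | 𝓕 t])
    (C := (dyadicSup P 𝓕 (fun ω => ‖x ω‖) ω).toReal) (fun s hs => ?_) h3 t, h2⟩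
  have := ENNReal.toReal_mono h1.ne (h2 s hs)
  rwa [toReal_enorm, Real.norm_eq_abs] at this

lemma tendsto_rightLimit (𝓕 : Filtration (Time T) mΩ) {x : Ω → ℝ} {ω : Ω}
    (hω : ω ∈ regularPaths P 𝓕 x) {t : Time T} (ht : t < ⊤) :
    Tendsto (fun s => P[x | 𝓕 s] ω) (𝓝[dyadic T ∩ Set.Ioi t] t)
      (𝓝 (rightLimit P 𝓕 x (regularPaths P 𝓕 x) t ω)) := by
  rw [rightLimit, if_pos hω, if_neg ht.ne]
  exact tendsto_nhds_limUnder (hω.1 t).1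

lemma rcll_rightLimit (𝓕 : Filtration (Time T) mΩ) (x : Ω → ℝ) (ω : Ω) (t : Time T) :
    ContinuousWithinAt (fun s => rightLimit P 𝓕 x (regularPaths P 𝓕 x) s ω) (Set.Ioi t) t ∧
    ∃ l, Tendsto (fun s => rightLimit P 𝓕 x (regularPaths P 𝓕 x) s ω) (𝓝[<] t) (𝓝 l) := by
  by_cases hω : ω ∈ regularPaths P 𝓕 x
  · exact rcll_of_dyadic_limits (fun t ht => tendsto_rightLimit 𝓕 hω ht) (fun t => (hω.1 t).2) t
  · have : (fun s => rightLimit P 𝓕 x (regularPaths P 𝓕 x) s ω) = fun _ => 0 :=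
      funext fun s => by rw [rightLimit, if_neg hω]
    rw [this]
    exact ⟨continuousWithinAt_const, 0, tendsto_const_nhds⟩

lemma enorm_rightLimit_le (𝓕 : Filtration (Time T) mΩ) (x : Ω → ℝ) (ω : Ω) (t : Time T) :
    ‖rightLimit P 𝓕 x (regularPaths P 𝓕 x) t ω‖ₑ ≤ dyadicSup P 𝓕 (fun ω => ‖x ω‖) ω := by
  by_cases hω : ω ∈ regularPaths P 𝓕 x
  · rcases eq_or_lt_of_le (le_top : t ≤ ⊤) with rfl | ht
    · rw [rightLimit, if_pos hω, if_pos rfl]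
      exact hω.2 ⊤ top_mem_dyadic
    · have := neBot_dyadic_right ht
      exact le_of_tendsto (tendsto_rightLimit 𝓕 hω ht).enorm
        (eventually_nhdsWithin_of_forall fun s hs => hω.2 s hs.1)
  · rw [rightLimit, if_neg hω]; simp

lemma exists_seq_dyadic_right {t : Time T} (ht : t < ⊤) :
    ∃ s : ℕ → Time T, Tendsto s atTop (𝓝[dyadic T ∩ Set.Ioi t] t) ∧
      ∀ n, s n ∈ dyadic T ∧ t < s n := by
  have := neBot_dyadic_right ht
  obtain ⟨s, hs⟩ := exists_seq_tendsto (𝓝[dyadic T ∩ Set.Ioi t] t)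
  obtain ⟨n₀, hn₀⟩ := eventually_atTop.1 (hs self_mem_nhdsWithin)
  exact ⟨fun n => s (n + n₀), hs.comp (tendsto_add_atTop_nat n₀),
    fun n => hn₀ _ (Nat.le_add_left _ _)⟩

/-- `regularPaths` quantifies over uncountably many times, so its measurability comes only from the
completeness of `𝓕 ⊥`. -/
lemma measurableSet_of_ae_mem {𝓕 : Filtration (Time T) mΩ} (h𝓕 : UsualConditions P 𝓕) {E : Set Ω}
    (hE : ∀ᵐ ω ∂P, ω ∈ E) (t : Time T) : MeasurableSet[𝓕 t] E := by
  have h := 𝓕.mono (bot_le : ⊥ ≤ t) _ (h𝓕.null_mem Eᶜ hE)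
  exact (MeasurableSet.compl_iff (m := 𝓕 t)).1 h

/-- For each `u > t` the limit can be taken along times in `(t, u)`, so it is `𝓕 u`-measurable;
right-continuity of the filtration brings this down to `𝓕 t`. -/
lemma stronglyMeasurable_rightLimit {𝓕 : Filtration (Time T) mΩ} (h𝓕 : UsualConditions P 𝓕)
    {x : Ω → ℝ} (hE : ∀ᵐ ω ∂P, ω ∈ regularPaths P 𝓕 x) (t : Time T) :
    StronglyMeasurable[𝓕 t] (rightLimit P 𝓕 x (regularPaths P 𝓕 x) t) := by
  set E := regularPaths P 𝓕 x with hEdef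
  have hEm := fun t => measurableSet_of_ae_mem h𝓕 hE t
  rcases eq_or_lt_of_le (le_top : t ≤ ⊤) with rfl | ht
  · have : rightLimit P 𝓕 x E ⊤ = E.indicator (P[x | 𝓕 ⊤]) := by
      funext ω
      by_cases hω : ω ∈ E <;> simp [rightLimit, hω]
    rw [this]
    exact stronglyMeasurable_condExp.indicator (hEm ⊤)
  obtain ⟨s, hs, hsD⟩ := exists_seq_dyadic_right ht
  have hlim : ∀ ω, Tendsto (fun n => E.indicator (P[x | 𝓕 (s n)]) ω) atTop
      (𝓝 (rightLimit P 𝓕 x E t ω)) := by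
    intro ω
    by_cases hω : ω ∈ E
    · simp only [Set.indicator_of_mem hω]
      exact (tendsto_rightLimit 𝓕 hω ht).comp hs
    · simp [rightLimit, hω]
  have hgt : ∀ u > t, Measurable[𝓕 u] (rightLimit P 𝓕 x E t) := by
    intro u hu
    have hev : ∀ᶠ n in atTop, s n < u :=
      (hs.mono_right nhdsWithin_le_nhds).eventually (gt_mem_nhds hu)
    obtain ⟨n₀, hn₀⟩ := eventually_atTop.1 hev
    refine @measurable_of_tendsto_metrizable Ω ℝ (𝓕 u) _ _ _ _
      (fun n => E.indicator (P[x | 𝓕 (s (n + n₀))])) _ (fun n => ?_)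
      (tendsto_pi_nhds.2 fun ω => (hlim ω).comp (tendsto_add_atTop_nat n₀))
    exact ((stronglyMeasurable_condExp.mono
      (𝓕.mono (hn₀ _ (Nat.le_add_left _ _)).le)).indicator (hEm u)).measurable
  have hm : Measurable[𝓕 t] (rightLimit P 𝓕 x E t) := by
    intro B hB
    have := h𝓕.rightContinuous
    refine Filtration.IsRightContinuous.measurableSet (𝓕 := 𝓕) ?_
    rw [Filtration.rightCont_eq_of_not_isMax 𝓕 (not_isMax_iff.2 ⟨⊤, ht⟩)]
    simp only [MeasurableSpace.measurableSet_iInf]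
    exact fun u hu => hgt u hu hB
  exact hm.stronglyMeasurable

/-- Over a set in `𝓕 t`, the integrals of the martingale at times `s n > t` all equal that of `x`.
Dominated convergence, with the dyadic supremum as bound, passes this to the right limit, which is
therefore the conditional expectation. -/
lemma rightLimit_ae_eq [IsProbabilityMeasure P] {𝓕 : Filtration (Time T) mΩ}
    (h𝓕 : UsualConditions P 𝓕) {x : Ω → ℝ} (hx : Integrable x P)
    (hS : ∫⁻ ω, dyadicSup P 𝓕 (fun ω => ‖x ω‖) ω ∂P < ∞)
    (hE : ∀ᵐ ω ∂P, ω ∈ regularPaths P 𝓕 x) (t : Time T) :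
    rightLimit P 𝓕 x (regularPaths P 𝓕 x) t =ᵐ[P] P[x | 𝓕 t] := by
  rcases eq_or_lt_of_le (le_top : t ≤ ⊤) with rfl | ht
  · filter_upwards [hE] with ω hω
    rw [rightLimit, if_pos hω, if_pos rfl]
  obtain ⟨s, hs, hsD⟩ := exists_seq_dyadic_right ht
  set S := dyadicSup P 𝓕 (fun ω => ‖x ω‖) with hSdef
  have hSfin : ∀ᵐ ω ∂P, S ω < ∞ := ae_lt_top (measurable_dyadicSup _ _) hS.ne
  have hSint : Integrable (fun ω => (S ω).toReal) P :=
    integrable_toReal_of_lintegral_ne_top (measurable_dyadicSup _ _).aemeasurable hS.ne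
  have hXm := stronglyMeasurable_rightLimit h𝓕 hE t
  have hXint : Integrable (rightLimit P 𝓕 x (regularPaths P 𝓕 x) t) P := by
    refine hSint.mono' (hXm.mono (𝓕.le t)).aestronglyMeasurable ?_
    filter_upwards [hSfin] with ω hω
    rw [← toReal_enorm]
    exact ENNReal.toReal_mono hω.ne (enorm_rightLimit_le 𝓕 x ω t)
  refine ae_eq_condExp_of_forall_setIntegral_eq (𝓕.le t) hx (fun _ _ _ => hXint.integrableOn)
    (fun A hA _ => ?_) hXm.aestronglyMeasurable
  have hconst : ∀ n, ∫ ω in A, P[x | 𝓕 (s n)] ω ∂P = ∫ ω in A, x ω ∂P := fun n =>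
    setIntegral_condExp (𝓕.le _) hx (𝓕.mono (hsD n).2.le _ hA)
  have hlim : Tendsto (fun n => ∫ ω in A, P[x | 𝓕 (s n)] ω ∂P) atTop
      (𝓝 (∫ ω in A, rightLimit P 𝓕 x (regularPaths P 𝓕 x) t ω ∂P)) := by
    refine tendsto_integral_of_dominated_convergence (fun ω => (S ω).toReal)
      (fun n => integrable_condExp.aestronglyMeasurable.restrict) hSint.integrableOn
      (fun n => ae_restrict_of_ae ?_) (ae_restrict_of_ae ?_)
    · filter_upwards [hSfin, hE] with ω h1 h2
      rw [← toReal_enorm]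
      exact ENNReal.toReal_mono h1.ne (h2.2 _ (hsD n).1)
    · filter_upwards [hE] with ω hω
      exact (tendsto_rightLimit 𝓕 hω ht).comp hs
  simp_rw [hconst] at hlim
  exact tendsto_nhds_unique hlim tendsto_const_nhds

/-- Under the usual conditions, the martingale closed by an element of `L^p(𝓕_T)`, `p > 1`, has a
right-continuous version with left limits, dominated by a random variable with finite `p`-norm. -/
theorem exists_rcll_version [IsProbabilityMeasure P] {𝓕 : Filtration (Time T) mΩ}
    (h𝓕 : UsualConditions P 𝓕) {p : ℝ≥0∞} (hp : 1 < p) {x : Ω → ℝ} (hx : MemLp x p P)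
    (hxm : StronglyMeasurable[𝓕 ⊤] x) :
    ∃ (X : Time T → Ω → ℝ) (S : Ω → ℝ≥0∞), StronglyAdapted 𝓕 X ∧
      (∀ ω t, ContinuousWithinAt (fun s => X s ω) (Set.Ioi t) t ∧
        ∃ l, Tendsto (fun s => X s ω) (𝓝[<] t) (𝓝 l)) ∧
      (∀ t, X t =ᵐ[P] P[x | 𝓕 t]) ∧ (∀ t ω, ‖X t ω‖ₑ ≤ S ω) ∧ Measurable S ∧
      (p ≠ ∞ → ∫⁻ ω, S ω ^ p.toReal ∂P < ∞) ∧
      (p = ∞ → ∃ C : ℝ, ∀ᵐ ω ∂P, S ω ≤ ENNReal.ofReal C) := by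
  have hxi : Integrable x P := hx.integrable hp.le
  set S := dyadicSup P 𝓕 (fun ω => ‖x ω‖) with hSdef
  have hyi : Integrable (fun ω => ‖x ω‖) P := hxi.norm
  have hfin : p ≠ ∞ → ∫⁻ ω, S ω ^ p.toReal ∂P < ∞ := by
    intro hp'
    have hp1 : 1 < p.toReal := by
      rw [← ENNReal.toReal_one]; exact (ENNReal.toReal_lt_toReal ENNReal.one_ne_top hp').2 hp
    refine (lintegral_dyadicSup_rpow_le 𝓕 (fun ω => norm_nonneg _) hyi hxm.norm hp1).trans_lt
      (doobBound_lt_top (fun ω => norm_nonneg _) (hxm.norm.mono (𝓕.le _)).measurable hp1 ?_)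
    simp_rw [ofReal_norm]
    exact lintegral_rpow_enorm_lt_top_of_eLpNorm_lt_top (zero_lt_one.trans hp).ne' hp' hx.2
  have hbdd : p = ∞ → ∃ C : ℝ, ∀ᵐ ω ∂P, S ω ≤ ENNReal.ofReal C := by
    rintro rfl
    refine ⟨(eLpNorm x ∞ P).toReal, dyadicSup_le_of_bounded 𝓕 ENNReal.toReal_nonneg ?_⟩
    filter_upwards [ae_le_eLpNormEssSup (f := x) (μ := P)] with ω hω
    rw [norm_norm, ← toReal_enorm, eLpNorm_exponent_top]
    exact ENNReal.toReal_mono (eLpNorm_exponent_top (f := x) (μ := P) ▸ hx.2.ne) hω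
  have hSint : ∫⁻ ω, S ω ∂P < ∞ := by
    by_cases hp' : p = ∞
    · obtain ⟨C, hC⟩ := hbdd hp'
      refine (lintegral_mono_ae hC).trans_lt ?_
      simp
    · have hp1 : 1 ≤ p.toReal := by
        rw [← ENNReal.toReal_one]; exact ENNReal.toReal_mono hp' hp.le
      refine (lintegral_mono (g := fun ω => 1 + S ω ^ p.toReal) fun ω => ?_).trans_lt ?_
      · rcases le_total (S ω) 1 with h | h
        · exact h.trans (le_add_right le_rfl)
        · refine le_trans ?_ (le_add_left le_rfl)
          simpa using ENNReal.rpow_le_rpow_of_exponent_le h hp1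
      · rw [lintegral_add_left measurable_const]
        simpa using hfin hp'
  have hE := ae_mem_regularPaths (x := x) 𝓕 (ae_lt_top (measurable_dyadicSup _ _) hSint.ne)
  exact ⟨rightLimit P 𝓕 x (regularPaths P 𝓕 x), S, stronglyMeasurable_rightLimit h𝓕 hE,
    rcll_rightLimit 𝓕 x, rightLimit_ae_eq h𝓕 hxi hSint hE,
    fun t ω => enorm_rightLimit_le 𝓕 x ω t, measurable_dyadicSup _ _, hfin, hbdd⟩

end ClosedMartingale

end BSE

namespace BSE

/-! ### Generalized conditional expectations of products. -/

section Measurability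

variable {Ω : Type*} {m : MeasurableSpace Ω} {d : ℕ}

lemma exists_level_sets {ξ : Ω → ℝ} (hξ : StronglyMeasurable[m] ξ) :
    Monotone (fun n : ℕ => {ω | |ξ ω| ≤ n}) ∧ (∀ n : ℕ, MeasurableSet[m] {ω | |ξ ω| ≤ n}) ∧
      (⋃ n : ℕ, {ω | |ξ ω| ≤ n}) = Set.univ := by
  refine ⟨fun i j hij ω (hω : |ξ ω| ≤ i) => ?_, fun n => ?_, Set.eq_univ_of_forall fun ω => ?_⟩
  · exact hω.trans (by exact_mod_cast hij)
  · have : Measurable[m] fun ω => |ξ ω| := hξ.norm.measurable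
    exact this measurableSet_Iic
  · obtain ⟨n, hn⟩ := exists_nat_ge |ξ ω|
    exact Set.mem_iUnion.2 ⟨n, hn⟩

lemma stronglyMeasurable_toLp {f : Fin d → Ω → ℝ} (hf : ∀ i, StronglyMeasurable[m] (f i)) :
    StronglyMeasurable[m] fun ω => (WithLp.toLp 2 fun i => f i ω : Vec d) := by
  have h1 : Measurable[m] fun ω i => f i ω :=
    @measurable_pi_lambda Ω (Fin d) (fun _ => ℝ) m _ _ fun i => (hf i).measurable
  exact (PiLp.continuous_toLp 2 fun _ : Fin d => ℝ).comp_stronglyMeasurable h1.stronglyMeasurable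

end Measurability

section GenCondExp

variable {Ω : Type*} {m : MeasurableSpace Ω} [mΩ : MeasurableSpace Ω] {P : Measure Ω} {d : ℕ}

lemma IsGenCondExpReal.congr {X X' Y Y' : Ω → ℝ} (h : IsGenCondExpReal m P X Y)
    (hX : X =ᵐ[P] X') (hY : Y =ᵐ[P] Y') : IsGenCondExpReal m P X' Y' where
  aestronglyMeasurable := h.aestronglyMeasurable.congr hX
  condIntegrable := by
    obtain ⟨A, hmono, hm, hU, hfin⟩ := h.condIntegrable
    refine ⟨A, hmono, hm, hU, fun n => ?_⟩
    have heq : (fun ω => ‖X' ω‖ₑ) =ᵐ[P] fun ω => ‖X ω‖ₑ := hX.symm.fun_comp fun a => ‖a‖ₑ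
    rw [lintegral_congr_ae (ae_restrict_of_ae heq)]
    exact hfin n
  aestronglyMeasurable_condExp := h.aestronglyMeasurable_condExp.congr hY
  setIntegral_eq A hA hint := by
    obtain ⟨h1, h2⟩ := h.setIntegral_eq A hA (hint.congr (ae_restrict_of_ae hX.symm))
    refine ⟨h1.congr (ae_restrict_of_ae hY), ?_⟩
    rw [← integral_congr_ae (ae_restrict_of_ae hX), h2, integral_congr_ae (ae_restrict_of_ae hY)]

/-- The sets `{|ξ| ≤ n}` witness conditional integrability. The identity over `A` is the usual
pull-out property for the factor `1_A ξ`, which applies exactly when the product is integrable on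
`A`. -/
lemma isGenCondExpReal_mul [IsFiniteMeasure P] (hm : m ≤ mΩ) {ξ x : Ω → ℝ}
    (hξ : StronglyMeasurable[m] ξ) (hx : Integrable x P) :
    IsGenCondExpReal m P (fun ω => ξ ω * x ω) (fun ω => ξ ω * P[x | m] ω) where
  aestronglyMeasurable := (hξ.mono hm).aestronglyMeasurable.mul hx.1
  condIntegrable := by
    obtain ⟨h1, h2, h3⟩ := exists_level_sets hξ
    refine ⟨_, h1, h2, h3, fun n => ?_⟩
    calc ∫⁻ ω in {ω | |ξ ω| ≤ n}, ‖ξ ω * x ω‖ₑ ∂P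
        ≤ ∫⁻ ω in {ω | |ξ ω| ≤ n}, (n : ℝ≥0∞) * ‖x ω‖ₑ ∂P := by
          refine setLIntegral_mono' (hm _ (h2 n)) fun ω hω => ?_
          rw [enorm_mul]
          gcongr
          rw [← ofReal_norm, ← ENNReal.ofReal_natCast]
          exact ENNReal.ofReal_le_ofReal hω
      _ ≤ ∫⁻ ω, (n : ℝ≥0∞) * ‖x ω‖ₑ ∂P := setLIntegral_le_lintegral _ _
      _ < ∞ := by
          rw [lintegral_const_mul' _ _ (ENNReal.natCast_ne_top n)]
          exact ENNReal.mul_lt_top (ENNReal.natCast_lt_top n) hx.2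
  aestronglyMeasurable_condExp :=
    (hξ.mul stronglyMeasurable_condExp).aestronglyMeasurable
  setIntegral_eq A hA hint := by
    have hAm := hm A hA
    have hint' : Integrable (A.indicator ξ * x) P := by
      refine ((integrable_indicator_iff hAm).2 hint).congr (ae_of_all _ fun ω => ?_)
      by_cases h : ω ∈ A <;> simp [h]
    have hpull := condExp_mul_of_stronglyMeasurable_left (m := m) (hξ.indicator hA) hint' hx
    have heq : A.indicator (fun ω => ξ ω * P[x | m] ω) = A.indicator ξ * P[x | m] := by
      funext ω; by_cases h : ω ∈ A <;> simp [h]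
    have heq' : A.indicator (fun ω => ξ ω * x ω) = A.indicator ξ * x := by
      funext ω; by_cases h : ω ∈ A <;> simp [h]
    constructor
    · rw [← integrable_indicator_iff hAm, heq]
      exact integrable_condExp.congr hpull
    · rw [← integral_indicator hAm, ← integral_indicator hAm, heq, heq', ← integral_congr_ae hpull,
        integral_condExp hm]

/-- On each localizing set `A n` both candidates agree with the ordinary conditional expectation of
`1_{A n} X`, and countably many such sets cover `Ω`. -/
lemma IsGenCondExpReal.ae_unique [IsFiniteMeasure P] (hm : m ≤ mΩ) {X Y Y' : Ω → ℝ}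
    (h : IsGenCondExpReal m P X Y) (h' : IsGenCondExpReal m P X Y') : Y =ᵐ[P] Y' := by
  obtain ⟨A, -, hA, hU, hfin⟩ := h.condIntegrable
  have key : ∀ n, ∀ {Z}, IsGenCondExpReal m P X Z →
      (A n).indicator Z =ᵐ[P] P[(A n).indicator X | m] := by
    intro n Z hZ
    have hAn := hm _ (hA n)
    have hX : IntegrableOn X (A n) P := ⟨h.aestronglyMeasurable.restrict, hfin n⟩
    have hZint := (hZ.setIntegral_eq _ (hA n) hX).1
    obtain ⟨Z', hZ', hZZ'⟩ := hZ.aestronglyMeasurable_condExp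
    refine ae_eq_condExp_of_forall_setIntegral_eq hm ((integrable_indicator_iff hAn).2 hX)
      (fun _ _ _ => ((integrable_indicator_iff hAn).2 hZint).integrableOn) (fun B hB _ => ?_)
      ⟨(A n).indicator Z', hZ'.indicator (hA n), hZZ'.mono fun ω hω => by
        simp only [Set.indicator, hω]⟩
    rw [setIntegral_indicator hAn, setIntegral_indicator hAn]
    exact (hZ.setIntegral_eq _ (hB.inter (hA n)) (hX.mono_set Set.inter_subset_right)).2.symm
  have hall : ∀ᵐ ω ∂P, ∀ n, (A n).indicator Y ω = (A n).indicator Y' ω :=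
    ae_all_iff.2 fun n => (key n h).trans (key n h').symm
  filter_upwards [hall] with ω hω
  obtain ⟨n, hn⟩ := Set.mem_iUnion.1 (hU ▸ Set.mem_univ ω)
  simpa [hn] using hω n

/-- Integrability of the difference on a set says nothing about the two terms there. Factoring out
`ρ = 1 + |ξ| + |ζ|` leaves coefficients bounded by 1, so the difference is `ρ` times one integrable
variable. -/
lemma isGenCondExpReal_mul_sub_mul [IsFiniteMeasure P] (hm : m ≤ mΩ) {ξ ζ x z : Ω → ℝ}
    (hξ : StronglyMeasurable[m] ξ) (hζ : StronglyMeasurable[m] ζ) (hx : Integrable x P)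
    (hz : Integrable z P) :
    IsGenCondExpReal m P (fun ω => ξ ω * x ω - ζ ω * z ω)
      (fun ω => ξ ω * P[x | m] ω - ζ ω * P[z | m] ω) := by
  set ρ : Ω → ℝ := fun ω => 1 + |ξ ω| + |ζ ω| with hρ
  have hρ0 : ∀ ω, 0 < ρ ω := fun ω => by positivity
  have hρm : StronglyMeasurable[m] ρ := (stronglyMeasurable_const.add hξ.norm).add hζ.norm
  have hquot : ∀ {η y : Ω → ℝ}, StronglyMeasurable[m] η → (∀ ω, |η ω| ≤ ρ ω) → Integrable y P →
      StronglyMeasurable[m] (η / ρ) ∧ Integrable ((η / ρ) * y) P := by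
    intro η y hη hle hy
    have hq : StronglyMeasurable[m] (η / ρ) := hη.div hρm
    refine ⟨hq, hy.bdd_mul (c := 1) (hq.mono hm).aestronglyMeasurable (ae_of_all _ fun ω => ?_)⟩
    rw [Pi.div_apply, Real.norm_eq_abs, abs_div, abs_of_pos (hρ0 ω), div_le_one (hρ0 ω)]
    exact hle ω
  obtain ⟨h1, h2⟩ := hquot hξ (fun ω => by simp only [hρ]; linarith [abs_nonneg (ζ ω)]) hx
  obtain ⟨h3, h4⟩ := hquot hζ (fun ω => by simp only [hρ]; linarith [abs_nonneg (ξ ω)]) hz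
  refine (isGenCondExpReal_mul hm hρm (h2.sub h4)).congr (ae_of_all _ fun ω => ?_) ?_
  · have := (hρ0 ω).ne'
    simp only [Pi.sub_apply, Pi.mul_apply, Pi.div_apply]
    field_simp
  · filter_upwards [condExp_sub h2 h4 m, condExp_mul_of_stronglyMeasurable_left h1 h2 hx,
      condExp_mul_of_stronglyMeasurable_left h3 h4 hz] with ω e1 e2 e3
    have := (hρ0 ω).ne'
    rw [e1, Pi.sub_apply, e2, e3]
    simp only [Pi.mul_apply, Pi.div_apply]
    field_simp

lemma integrable_apply {x : Ω → Vec d} (hx : Integrable x P) (i : Fin d) :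
    Integrable (fun ω => x ω i) P :=
  (EuclideanSpace.proj (𝕜 := ℝ) i).integrable_comp hx

lemma isGenCondExp_of_smul [IsFiniteMeasure P] (hm : m ≤ mΩ) {V Z : Ω →ₘ[P] Vec d} {ξ : Ω → ℝ}
    {x : Ω → Vec d} (hξ : StronglyMeasurable[m] ξ) (hx : Integrable x P)
    (hV : V =ᵐ[P] fun ω => ξ ω • x ω)
    (hZ : ∀ i, ∀ᵐ ω ∂P, Z ω i = ξ ω * P[fun ω => x ω i | m] ω) : IsGenCondExp m P V Z := by
  intro i
  refine (isGenCondExpReal_mul hm hξ (integrable_apply hx i)).congr ?_ ((hZ i).mono fun _ h => h.symm)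
  filter_upwards [hV] with ω hω
  rw [hω]; simp

lemma IsGenCondExp.unique [IsFiniteMeasure P] (hm : m ≤ mΩ) {V Z Z' : Ω →ₘ[P] Vec d}
    (h : IsGenCondExp m P V Z) (h' : IsGenCondExp m P V Z') : Z = Z' := by
  refine AEEqFun.ext ?_
  have : ∀ᵐ ω ∂P, ∀ i, Z ω i = Z' ω i := ae_all_iff.2 fun i => (h i).ae_unique hm (h' i)
  filter_upwards [this] with ω hω
  ext i
  exact hω i

lemma IsGenCondExp.genCondExp_eq [IsFiniteMeasure P] (hm : m ≤ mΩ) {V Z : Ω →ₘ[P] Vec d}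
    (h : IsGenCondExp m P V Z) : genCondExp m P V = Z :=
  IsGenCondExp.unique hm (Classical.epsilon_spec (p := fun Y => IsGenCondExp m P V Y) ⟨Z, h⟩) h

variable (m P) in
/-- The vector of the conditional expectations of the components of `x`. -/
noncomputable def condExpVec (x : Ω → Vec d) (ω : Ω) : Vec d :=
  WithLp.toLp 2 fun i => P[fun ω => x ω i | m] ω

lemma stronglyMeasurable_condExpVec (x : Ω → Vec d) : StronglyMeasurable[m] (condExpVec m P x) :=
  stronglyMeasurable_toLp fun _ => stronglyMeasurable_condExp

lemma isGenCondExp_smul_condExpVec [IsFiniteMeasure P] (hm : m ≤ mΩ) {V Z : Ω →ₘ[P] Vec d}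
    {ξ : Ω → ℝ} {x : Ω → Vec d} (hξ : StronglyMeasurable[m] ξ) (hx : Integrable x P)
    (hV : V =ᵐ[P] fun ω => ξ ω • x ω) (hZ : Z =ᵐ[P] fun ω => ξ ω • condExpVec m P x ω) :
    IsGenCondExp m P V Z := by
  refine isGenCondExp_of_smul hm hξ hx hV fun i => ?_
  filter_upwards [hZ] with ω hω
  rw [hω]; simp [condExpVec]

lemma exists_isGenCondExp_smul [IsFiniteMeasure P] (hm : m ≤ mΩ) {V : Ω →ₘ[P] Vec d}
    {ξ : Ω → ℝ} {x : Ω → Vec d} (hξ : StronglyMeasurable[m] ξ) (hx : Integrable x P)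
    (hV : V =ᵐ[P] fun ω => ξ ω • x ω) :
    IsGenCondExp m P V (genCondExp m P V) ∧
      genCondExp m P V =ᵐ[P] fun ω => ξ ω • condExpVec m P x ω := by
  have hZ : AEStronglyMeasurable (fun ω => ξ ω • condExpVec m P x ω) P :=
    ((hξ.smul (stronglyMeasurable_condExpVec x)).mono hm).aestronglyMeasurable
  have h := isGenCondExp_smul_condExpVec hm hξ hx hV (AEEqFun.coeFn_mk _ hZ)
  rw [h.genCondExp_eq hm]
  exact ⟨h, AEEqFun.coeFn_mk _ hZ⟩

lemma condExpVec_of_stronglyMeasurable [IsFiniteMeasure P] (hm : m ≤ mΩ) {x : Ω → Vec d}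
    (hx : Integrable x P) (hxm : StronglyMeasurable[m] x) : condExpVec m P x = x := by
  funext ω
  ext i
  have : StronglyMeasurable[m] fun ω => x ω i :=
    (EuclideanSpace.proj (𝕜 := ℝ) i).continuous.comp_stronglyMeasurable hxm
  change P[fun ω => x ω i | m] ω = x ω i
  rw [condExp_of_stronglyMeasurable hm this (integrable_apply hx i)]

lemma isGenCondExp_sub [IsFiniteMeasure P] (hm : m ≤ mΩ) {V W V' W' : Ω →ₘ[P] Vec d}
    {ξ ζ : Ω → ℝ} {x z : Ω → Vec d} (hξ : StronglyMeasurable[m] ξ) (hx : Integrable x P)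
    (hζ : StronglyMeasurable[m] ζ) (hz : Integrable z P)
    (hV : V =ᵐ[P] fun ω => ξ ω • x ω) (hW : W =ᵐ[P] fun ω => ζ ω • z ω)
    (hV' : V' =ᵐ[P] fun ω => ξ ω • condExpVec m P x ω)
    (hW' : W' =ᵐ[P] fun ω => ζ ω • condExpVec m P z ω) : IsGenCondExp m P (V - W) (V' - W') := by
  intro i
  refine (isGenCondExpReal_mul_sub_mul hm hξ hζ (integrable_apply hx i)
    (integrable_apply hz i)).congr ?_ ?_
  · filter_upwards [hV, hW, AEEqFun.coeFn_sub V W] with ω h1 h2 h3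
    rw [h3, Pi.sub_apply, h1, h2]; simp
  · filter_upwards [hV', hW', AEEqFun.coeFn_sub V' W'] with ω h1 h2 h3
    rw [h3, Pi.sub_apply, h1, h2]; simp [condExpVec]

/-- A conditionally integrable function becomes integrable after multiplication with a suitable
positive `m`-measurable weight. -/
lemma CondIntegrable.exists_weight (hm : m ≤ mΩ) {g : Ω → ℝ≥0∞} (hg : CondIntegrable m P g) :
    ∃ w : Ω → ℝ, StronglyMeasurable[m] w ∧ (∀ ω, 0 < w ω) ∧
      ∫⁻ ω, ENNReal.ofReal (w ω) * g ω ∂P < ∞ := by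
  classical
  obtain ⟨A, -, hA, hU, hfin⟩ := hg
  obtain ⟨δ, hδ, hsum⟩ := ENNReal.exists_pos_tsum_mul_lt_of_countable one_ne_zero
    (fun n => ∫⁻ ω in A n, g ω ∂P) fun n => (hfin n).ne
  have hex : ∀ ω, ∃ n, ω ∈ A n := fun ω => Set.mem_iUnion.1 (hU ▸ Set.mem_univ ω)
  -- `N` is the first index whose set contains the point. The weight is `δ n` on `{N = n} ⊆ A n`,
  -- and `δ` was chosen to make the sum of `δ n ∫_{A n} g` finite.
  set N : Ω → ℕ := fun ω => Nat.find (hex ω) with hN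
  have hNm : Measurable[m] N := @measurable_find Ω m (fun ω n => ω ∈ A n) _ hex hA
  have hB : ∀ n, MeasurableSet (N ⁻¹' {n}) := fun n => hm _ (hNm (measurableSet_singleton n))
  have hcover : (⋃ n, N ⁻¹' {n}) = Set.univ := Set.eq_univ_of_forall fun ω => by simp
  refine ⟨fun ω => δ (N ω), ?_, fun ω => by exact_mod_cast hδ _, ?_⟩
  · have : Measurable[m] fun ω => (δ (N ω) : ℝ) :=
      (measurable_from_nat (f := fun n => (δ n : ℝ))).comp hNm
    exact this.stronglyMeasurable
  · rw [← setLIntegral_univ, ← hcover, lintegral_iUnion hB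
      (fun i j hij => Disjoint.preimage N (by simpa using hij))]
    refine lt_of_le_of_lt (ENNReal.tsum_le_tsum fun n => ?_) (hsum.trans ENNReal.one_lt_top)
    calc ∫⁻ ω in N ⁻¹' {n}, ENNReal.ofReal (δ (N ω)) * g ω ∂P
        = ∫⁻ ω in N ⁻¹' {n}, (δ n : ℝ≥0∞) * g ω ∂P := by
          refine setLIntegral_congr_fun (hB n) fun ω hω => ?_
          have : N ω = n := hω
          simp only [this, ENNReal.ofReal_coe_nnreal]
      _ = (δ n : ℝ≥0∞) * ∫⁻ ω in N ⁻¹' {n}, g ω ∂P :=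
          lintegral_const_mul' _ _ ENNReal.coe_ne_top
      _ ≤ (∫⁻ ω in A n, g ω ∂P) * δ n := by
          rw [mul_comm]
          gcongr
          intro ω hω
          have : N ω = n := hω
          exact this ▸ Nat.find_spec (hex ω)

end GenCondExp

/-! ### The spaces `L^p_{𝓕_0}`, `S^p_{𝓕_0}` and `M^p_{𝓕_0,0}`. -/

section Modules

variable {Ω : Type*} [mΩ : MeasurableSpace Ω] {P : Measure Ω} {T : ℝ≥0} {d : ℕ}
  {𝓕 : Filtration (Time T) mΩ} {p : ℝ≥0∞}

lemma neg_mem_LpMod {V : Ω →ₘ[P] Vec d} (hV : V ∈ LpMod P 𝓕 d p) : -V ∈ LpMod P 𝓕 d p := by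
  obtain ⟨ξ, x, hξ, hx, hxp, hV⟩ := hV
  refine ⟨ξ, -x, hξ, hx.neg, hxp.neg, ?_⟩
  filter_upwards [hV, AEEqFun.coeFn_neg V] with ω h1 h2
  rw [h2, Pi.neg_apply, h1]; simp

/-- Both summands are rewritten over the common factor `ρ`; the quotients `ξ / ρ` and `ζ / ρ` are
bounded by 1, so the remaining vectors stay in `L^p`. -/
lemma add_mem_LpMod {V W : Ω →ₘ[P] Vec d} (hV : V ∈ LpMod P 𝓕 d p) (hW : W ∈ LpMod P 𝓕 d p) :
    V + W ∈ LpMod P 𝓕 d p := by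
  obtain ⟨ξ, x, hξ, hx, hxp, hV⟩ := hV
  obtain ⟨ζ, z, hζ, hz, hzp, hW⟩ := hW
  set ρ : Ω → ℝ := fun ω => 1 + |ξ ω| + |ζ ω| with hρ
  have hρ0 : ∀ ω, 0 < ρ ω := fun ω => by positivity
  have hρm : StronglyMeasurable[𝓕 ⊥] ρ := (stronglyMeasurable_const.add hξ.norm).add hζ.norm
  have hquot : ∀ {η : Ω → ℝ} {y : Ω → Vec d}, StronglyMeasurable[𝓕 ⊥] η → (∀ ω, |η ω| ≤ ρ ω) →
      StronglyMeasurable[𝓕 ⊤] y → MemLp y p P →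
      StronglyMeasurable[𝓕 ⊤] (fun ω => (η ω / ρ ω) • y ω) ∧
        MemLp (fun ω => (η ω / ρ ω) • y ω) p P := by
    intro η y hη hle hy hyp
    have hq : StronglyMeasurable[𝓕 ⊤] (fun ω => (η ω / ρ ω) • y ω) :=
      ((hη.div hρm).mono (𝓕.mono bot_le)).smul hy
    refine ⟨hq, hyp.mono (hq.mono (𝓕.le _)).aestronglyMeasurable (ae_of_all _ fun ω => ?_)⟩
    rw [norm_smul, Real.norm_eq_abs, abs_div, abs_of_pos (hρ0 ω)]
    exact mul_le_of_le_one_left (norm_nonneg _) ((div_le_one (hρ0 ω)).2 (hle ω))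
  obtain ⟨h1, h2⟩ := hquot hξ (fun ω => by simp only [hρ]; linarith [abs_nonneg (ζ ω)]) hx hxp
  obtain ⟨h3, h4⟩ := hquot hζ (fun ω => by simp only [hρ]; linarith [abs_nonneg (ξ ω)]) hz hzp
  refine ⟨ρ, _, hρm, h1.add h3, h2.add h4, ?_⟩
  filter_upwards [hV, hW, AEEqFun.coeFn_add V W] with ω e1 e2 e3
  rw [e3, Pi.add_apply, e1, e2]
  simp only [Pi.add_apply, smul_add, smul_smul, mul_div_cancel₀ _ (hρ0 ω).ne']

lemma sub_mem_LpMod {V W : Ω →ₘ[P] Vec d} (hV : V ∈ LpMod P 𝓕 d p) (hW : W ∈ LpMod P 𝓕 d p) :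
    V - W ∈ LpMod P 𝓕 d p :=
  sub_eq_add_neg V W ▸ add_mem_LpMod hV (neg_mem_LpMod hW)

lemma exists_smul_of_mem_L0 [IsProbabilityMeasure P] {y : Ω →ₘ[P] Vec d} (hy : y ∈ L0 (𝓕 ⊥) P d) :
    ∃ (ξ : Ω → ℝ) (x : Ω → Vec d), StronglyMeasurable[𝓕 ⊥] ξ ∧ StronglyMeasurable[𝓕 ⊥] x ∧
      MemLp x p P ∧ y =ᵐ[P] fun ω => ξ ω • x ω := by
  obtain ⟨y', hy', heq⟩ := hy
  have hpos : ∀ ω, 0 < 1 + ‖y' ω‖ := fun ω => by positivity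
  have hξ : StronglyMeasurable[𝓕 ⊥] fun ω => 1 + ‖y' ω‖ := stronglyMeasurable_const.add hy'.norm
  have hx : StronglyMeasurable[𝓕 ⊥] fun ω => (1 + ‖y' ω‖)⁻¹ • y' ω :=
    (hξ.measurable.inv.stronglyMeasurable).smul hy'
  refine ⟨_, _, hξ, hx, MemLp.of_bound (hx.mono (𝓕.le _)).aestronglyMeasurable 1
    (ae_of_all _ fun ω => ?_), ?_⟩
  · rw [norm_smul, norm_inv, Real.norm_of_nonneg (hpos ω).le, inv_mul_le_one₀ (hpos ω)]
    linarith
  · filter_upwards [heq] with ω hω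
    rw [hω, smul_smul, mul_inv_cancel₀ (hpos ω).ne', one_smul]

/-- For `p = ∞` the factor is `1 + |η|`. For `p < ∞`, a weight `w` making `w (sup |X|)^p` integrable
gives the factor `w^(-1/p)`. -/
lemma mem_LpMod_of_mem_Sp (hp : 1 < p) {Y : Proc P T d} (hY : Y ∈ Sp P 𝓕 d p) (t : Time T) :
    Y t ∈ LpMod P 𝓕 d p := by
  obtain ⟨X, hX, hYX, hfin, hbdd⟩ := hY
  have hXm : StronglyMeasurable[𝓕 ⊤] (X t) := (hX.adapted t).mono (𝓕.mono le_top)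
  have hsup : ∀ ω, ‖X t ω‖ₑ ≤ ⨆ t, ‖X t ω‖ₑ := fun ω => le_iSup (fun t => ‖X t ω‖ₑ) t
  by_cases hp' : p = ∞
  · obtain ⟨η, hη, hle⟩ := hbdd hp'
    have hpos : ∀ ω, 0 < 1 + |η ω| := fun ω => by positivity
    have hξ : StronglyMeasurable[𝓕 ⊥] fun ω => 1 + |η ω| := stronglyMeasurable_const.add hη.norm
    have hx : StronglyMeasurable[𝓕 ⊤] fun ω => (1 + |η ω|)⁻¹ • X t ω :=
      ((hξ.measurable.inv.stronglyMeasurable).mono (𝓕.mono bot_le)).smul hXm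
    refine ⟨_, _, hξ, hx, hp' ▸ memLp_top_of_bound (hx.mono (𝓕.le _)).aestronglyMeasurable 1 ?_, ?_⟩
    · filter_upwards [hle] with ω hω
      have h1 := (hsup ω).trans hω
      rw [← ofReal_norm] at h1
      have h2 : ‖X t ω‖ ≤ |η ω| := by
        rcases le_or_gt (η ω) 0 with h0 | h0
        · rw [ENNReal.ofReal_of_nonpos h0, nonpos_iff_eq_zero, ENNReal.ofReal_eq_zero] at h1
          exact h1.trans (abs_nonneg _)
        · exact ((ENNReal.ofReal_le_ofReal_iff h0.le).1 h1).trans (le_abs_self _)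
      rw [norm_smul, norm_inv, Real.norm_of_nonneg (hpos ω).le, inv_mul_le_one₀ (hpos ω)]
      linarith
    · filter_upwards [hYX t] with ω hω
      rw [hω, smul_smul, mul_inv_cancel₀ (hpos ω).ne', one_smul]
  · obtain ⟨w, hw, hw0, hwint⟩ := (hfin hp').exists_weight (𝓕.le _)
    have hp0 : p ≠ 0 := (zero_lt_one.trans hp).ne'
    have hpr : 0 < p.toReal := ENNReal.toReal_pos hp0 hp'
    have hv0 : ∀ ω, 0 < w ω ^ (p.toReal)⁻¹ := fun ω => Real.rpow_pos_of_pos (hw0 ω) _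
    have hv : Measurable[𝓕 ⊥] fun ω => w ω ^ (p.toReal)⁻¹ := hw.measurable.pow_const _
    have hx : StronglyMeasurable[𝓕 ⊤] fun ω => (w ω ^ (p.toReal)⁻¹) • X t ω :=
      (hv.stronglyMeasurable.mono (𝓕.mono bot_le)).smul hXm
    refine ⟨_, _, hv.inv.stronglyMeasurable, hx,
      ⟨(hx.mono (𝓕.le _)).aestronglyMeasurable, ?_⟩, ?_⟩
    · rw [eLpNorm_lt_top_iff_lintegral_rpow_enorm_lt_top hp0 hp']
      refine (lintegral_mono fun ω => ?_).trans_lt hwint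
      rw [enorm_smul, ENNReal.mul_rpow_of_nonneg _ _ hpr.le]
      gcongr
      · rw [← ofReal_norm, Real.norm_of_nonneg (hv0 ω).le,
          ENNReal.ofReal_rpow_of_nonneg (hv0 ω).le hpr.le, ← Real.rpow_mul (hw0 ω).le,
          inv_mul_cancel₀ hpr.ne', Real.rpow_one]
      · exact hsup ω
    · filter_upwards [hYX t] with ω hω
      rw [hω]
      simp only [Pi.inv_apply]
      rw [smul_smul, inv_mul_cancel₀ (hv0 ω).ne', one_smul]

lemma bot_mem_L0_of_mem_Sp {Y : Proc P T d} (hY : Y ∈ Sp P 𝓕 d p) : Y ⊥ ∈ L0 (𝓕 ⊥) P d := by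
  obtain ⟨X, hX, hYX, -⟩ := hY
  exact ⟨X ⊥, hX.adapted ⊥, hYX ⊥⟩

lemma enorm_toLp_le_sum (v : Fin d → ℝ) : ‖(WithLp.toLp 2 v : Vec d)‖ₑ ≤ ∑ i, ‖v i‖ₑ := by
  have h : (WithLp.toLp 2 v : Vec d) = ∑ i, v i • EuclideanSpace.single i (1 : ℝ) := by
    ext j
    simp [Pi.single_apply]
  rw [h]
  refine (enorm_sum_le _ _).trans (Finset.sum_le_sum fun i _ => ?_)
  rw [enorm_smul]
  simp [← ofReal_norm]

/-- The vector-valued version of `exists_rcll_version`. -/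
theorem exists_rcll_version_vec [IsProbabilityMeasure P] (h𝓕 : UsualConditions P 𝓕) (hp : 1 < p)
    {x : Ω → Vec d} (hx : MemLp x p P) (hxm : StronglyMeasurable[𝓕 ⊤] x) :
    ∃ (X : Time T → Ω → Vec d) (S : Ω → ℝ≥0∞), IsRCLLAdapted 𝓕 X ∧
      (∀ t, X t =ᵐ[P] condExpVec (𝓕 t) P x) ∧ (∀ t ω, ‖X t ω‖ₑ ≤ S ω) ∧
      (p ≠ ∞ → ∫⁻ ω, S ω ^ p.toReal ∂P < ∞) ∧
      (p = ∞ → ∃ C : ℝ, 0 ≤ C ∧ ∀ᵐ ω ∂P, S ω ≤ ENNReal.ofReal C) := by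
  have hcomp : ∀ i, MemLp (fun ω => x ω i) p P := fun i =>
    (EuclideanSpace.proj (𝕜 := ℝ) i : Vec d →L[ℝ] ℝ).comp_memLp' hx
  have hcompm : ∀ i, StronglyMeasurable[𝓕 ⊤] fun ω => x ω i := fun i =>
    (EuclideanSpace.proj (𝕜 := ℝ) i).continuous.comp_stronglyMeasurable hxm
  choose X S hadapt hrcll hver hdom hSm hfin hbdd using fun i =>
    exists_rcll_version h𝓕 hp (hcomp i) (hcompm i)
  have hcont := PiLp.continuous_toLp 2 fun _ : Fin d => ℝ
  refine ⟨fun t ω => WithLp.toLp 2 fun i => X i t ω, fun ω => ∑ i, S i ω, ⟨fun t => ?_, ?_, ?_⟩,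
    fun t => ?_, fun t ω => ?_, fun hp' => ?_, fun hp' => ?_⟩
  · exact stronglyMeasurable_toLp fun i => hadapt i t
  · intro ω t
    exact (hcont.tendsto _).comp (tendsto_pi_nhds.2 fun i => (hrcll i ω t).1)
  · intro ω t
    choose l hl using fun i => (hrcll i ω t).2
    exact ⟨_, (hcont.tendsto l).comp (tendsto_pi_nhds.2 hl)⟩
  · filter_upwards [ae_all_iff.2 fun i => hver i t] with ω hω
    simp only [condExpVec, hω]
  · exact (enorm_toLp_le_sum _).trans (Finset.sum_le_sum fun i _ => hdom i t ω)
  · have hp1 : 1 ≤ p.toReal := by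
      rw [← ENNReal.toReal_one]; exact ENNReal.toReal_mono hp' hp.le
    refine (lintegral_mono fun ω => ENNReal.rpow_sum_le_const_mul_sum_rpow Finset.univ
      (fun i => S i ω) hp1).trans_lt ?_
    rw [lintegral_const_mul' _ _ (ENNReal.rpow_ne_top_of_nonneg (by linarith) (by simp)),
      lintegral_finsetSum _ fun i _ => (hSm i).pow_const _]
    exact ENNReal.mul_lt_top (ENNReal.rpow_lt_top_of_nonneg (by linarith) (by simp))
      (ENNReal.sum_lt_top.2 fun i _ => hfin i hp')
  · choose C hC using fun i => hbdd i hp'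
    refine ⟨∑ i, max (C i) 0, Finset.sum_nonneg fun i _ => le_max_right _ _, ?_⟩
    filter_upwards [ae_all_iff.2 hC] with ω hω
    rw [ENNReal.ofReal_sum_of_nonneg fun i _ => le_max_right _ _]
    exact Finset.sum_le_sum fun i _ => (hω i).trans (ENNReal.ofReal_le_ofReal (le_max_left _ _))

lemma condLpFinite_of_le_mul {ξ : Ω → ℝ} (hξ : StronglyMeasurable[𝓕 ⊥] ξ) {g S : Ω → ℝ≥0∞}
    (hg : ∀ ω, g ω ≤ ‖ξ ω‖ₑ * S ω) (hfin : p ≠ ∞ → ∫⁻ ω, S ω ^ p.toReal ∂P < ∞)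
    (hbdd : p = ∞ → ∃ C : ℝ, 0 ≤ C ∧ ∀ᵐ ω ∂P, S ω ≤ ENNReal.ofReal C) :
    CondLpFinite (𝓕 ⊥) P p g := by
  refine ⟨fun hp' => ?_, fun hp' => ?_⟩
  · have hpr : 0 ≤ p.toReal := ENNReal.toReal_nonneg
    obtain ⟨h1, h2, h3⟩ := exists_level_sets hξ
    refine ⟨_, h1, h2, h3, fun n => ?_⟩
    calc ∫⁻ ω in {ω | |ξ ω| ≤ n}, g ω ^ p.toReal ∂P
        ≤ ∫⁻ ω in {ω | |ξ ω| ≤ n}, (n : ℝ≥0∞) ^ p.toReal * S ω ^ p.toReal ∂P := by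
          refine setLIntegral_mono' (𝓕.le _ _ (h2 n)) fun ω hω => ?_
          rw [← ENNReal.mul_rpow_of_nonneg _ _ hpr]
          gcongr
          refine (hg ω).trans ?_
          gcongr
          rw [← ofReal_norm, ← ENNReal.ofReal_natCast]
          exact ENNReal.ofReal_le_ofReal hω
      _ ≤ ∫⁻ ω, (n : ℝ≥0∞) ^ p.toReal * S ω ^ p.toReal ∂P := setLIntegral_le_lintegral _ _
      _ < ∞ := by
          have hn : (n : ℝ≥0∞) ^ p.toReal < ∞ :=
            ENNReal.rpow_lt_top_of_nonneg hpr (ENNReal.natCast_ne_top n)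
          rw [lintegral_const_mul' _ _ hn.ne]
          exact ENNReal.mul_lt_top hn (hfin hp')
  · obtain ⟨C, hC, hSC⟩ := hbdd hp'
    refine ⟨fun ω => |ξ ω| * C, hξ.norm.mul_const C, ?_⟩
    filter_upwards [hSC] with ω hω
    rw [ENNReal.ofReal_mul (abs_nonneg _), ← Real.norm_eq_abs, ofReal_norm]
    exact (hg ω).trans (by gcongr)

/-- A representation `ξ x` of an element of `L^p_{𝓕_0}(𝓕_T, R^d)` yields its generalized
conditional expectations. -/
lemma genCondExp_of_smul [IsProbabilityMeasure P] {V : Ω →ₘ[P] Vec d} {ξ : Ω → ℝ} {x : Ω → Vec d}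
    (hξ : StronglyMeasurable[𝓕 ⊥] ξ) (hx : Integrable x P)
    (hV : V =ᵐ[P] fun ω => ξ ω • x ω) (t : Time T) :
    IsGenCondExp (𝓕 t) P V (genCondExp (𝓕 t) P V) ∧
      genCondExp (𝓕 t) P V =ᵐ[P] fun ω => ξ ω • condExpVec (𝓕 t) P x ω :=
  exists_isGenCondExp_smul (𝓕.le t) (hξ.mono (𝓕.mono bot_le)) hx hV

lemma isGenCondExp_iff [IsProbabilityMeasure P] (hp : 1 < p) {V : Ω →ₘ[P] Vec d}
    (hV : V ∈ LpMod P 𝓕 d p) (t : Time T) (Z : Ω →ₘ[P] Vec d) :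
    IsGenCondExp (𝓕 t) P V Z ↔ Z = genCondExp (𝓕 t) P V := by
  obtain ⟨ξ, x, hξ, -, hxp, hV⟩ := hV
  have h := (genCondExp_of_smul hξ (hxp.integrable hp.le) hV t).1
  exact ⟨fun hZ => hZ.unique (𝓕.le t) h, fun hZ => hZ ▸ h⟩

lemma genCondExp_bot_mem_L0 [IsProbabilityMeasure P] (hp : 1 < p) {V : Ω →ₘ[P] Vec d}
    (hV : V ∈ LpMod P 𝓕 d p) : genCondExp (𝓕 ⊥) P V ∈ L0 (𝓕 ⊥) P d := by
  obtain ⟨ξ, x, hξ, -, hxp, hV⟩ := hV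
  exact ⟨_, hξ.smul (stronglyMeasurable_condExpVec x),
    (genCondExp_of_smul hξ (hxp.integrable hp.le) hV ⊥).2⟩

lemma genCondExp_top [IsProbabilityMeasure P] (hp : 1 < p) {V : Ω →ₘ[P] Vec d}
    (hV : V ∈ LpMod P 𝓕 d p) : genCondExp (𝓕 ⊤) P V = V := by
  obtain ⟨ξ, x, hξ, hx, hxp, hV⟩ := hV
  have hxi := hxp.integrable hp.le
  refine AEEqFun.ext ((genCondExp_of_smul hξ hxi hV ⊤).2.trans ?_)
  rw [condExpVec_of_stronglyMeasurable (𝓕.le _) hxi hx]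
  exact hV.symm

lemma MV_mem_Mp0 [IsProbabilityMeasure P] (h𝓕 : UsualConditions P 𝓕) (hp : 1 < p)
    {V : Ω →ₘ[P] Vec d} (hV : V ∈ LpMod P 𝓕 d p) : MV P 𝓕 V ∈ Mp0 P 𝓕 d p := by
  obtain ⟨ξ, x, hξ, hx, hxp, hV⟩ := hV
  have hxi := hxp.integrable hp.le
  have hE := fun t => (genCondExp_of_smul (𝓕 := 𝓕) hξ hxi hV t).2
  have hMV : ∀ t, MV P 𝓕 V t =ᵐ[P] fun ω =>
      ξ ω • (condExpVec (𝓕 ⊥) P x ω - condExpVec (𝓕 t) P x ω) := fun t => by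
    filter_upwards [hE ⊥, hE t, AEEqFun.coeFn_sub (genCondExp (𝓕 ⊥) P V) (genCondExp (𝓕 t) P V)]
      with ω h1 h2 h3
    rw [MV, h3, Pi.sub_apply, h1, h2, smul_sub]
  refine ⟨⟨?_, by simp [MV]⟩, fun s t hst i => ?_⟩
  · obtain ⟨X, S, hX, hver, hdom, hfin, hbdd⟩ := exists_rcll_version_vec h𝓕 hp hxp hx
    refine ⟨fun t ω => ξ ω • (X ⊥ ω - X t ω), ⟨fun t => ?_, fun ω t => ?_, fun ω t => ?_⟩,
      fun t => ?_, ?_⟩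
    · exact (hξ.mono (𝓕.mono bot_le)).smul
        (((hX.adapted ⊥).mono (𝓕.mono bot_le)).sub (hX.adapted t))
    · exact (continuousWithinAt_const.sub (hX.rightContinuous ω t)).const_smul (ξ ω)
    · obtain ⟨l, hl⟩ := hX.leftLimit ω t
      exact ⟨_, (tendsto_const_nhds.sub hl).const_smul (ξ ω)⟩
    · filter_upwards [hMV t, hver ⊥, hver t] with ω h1 h2 h3
      rw [h1, h2, h3]
    · refine condLpFinite_of_le_mul hξ (S := fun ω => 2 * S ω) (fun ω => iSup_le fun t => ?_)
        (fun hp' => ?_) fun hp' => ?_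
      · rw [enorm_smul, two_mul]
        gcongr
        exact enorm_sub_le.trans (add_le_add (hdom ⊥ ω) (hdom t ω))
      · simp_rw [ENNReal.mul_rpow_of_nonneg _ _ (ENNReal.toReal_nonneg (a := p))]
        have h2 : (2 : ℝ≥0∞) ^ p.toReal < ∞ :=
          ENNReal.rpow_lt_top_of_nonneg ENNReal.toReal_nonneg (by simp)
        rw [lintegral_const_mul' _ _ h2.ne]
        exact ENNReal.mul_lt_top h2 (hfin hp')
      · obtain ⟨C, hC, hSC⟩ := hbdd hp'
        refine ⟨2 * C, by positivity, ?_⟩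
        filter_upwards [hSC] with ω hω
        rw [ENNReal.ofReal_mul zero_le_two, ENNReal.ofReal_ofNat]
        gcongr
  · set y : Ω → ℝ := fun ω => x ω i with hy
    have hm : 𝓕 s ≤ mΩ := 𝓕.le s
    -- For the martingale property, the pull-out lemma is applied to `ξ` and `E_0 y - E_t y`, whose
    -- conditional expectation at `s` is `E_0 y - E_s y` by the tower property.
    refine (isGenCondExpReal_mul hm (hξ.mono (𝓕.mono bot_le))
      ((integrable_condExp (m := 𝓕 ⊥) (f := y)).sub
        (integrable_condExp (m := 𝓕 t) (f := y)))).congr ?_ ?_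
    · filter_upwards [hMV t] with ω hω
      rw [hω]; simp [condExpVec, hy]
    · filter_upwards [hMV s, condExp_sub (integrable_condExp (m := 𝓕 ⊥) (f := y) (μ := P))
        (integrable_condExp (m := 𝓕 t) (f := y)) (𝓕 s),
        𝓕.condExp_condExp y hst.le] with ω h1 h2 h3
      rw [h1, h2, Pi.sub_apply, h3, condExp_of_stronglyMeasurable hm
        (stronglyMeasurable_condExp.mono (𝓕.mono bot_le)) integrable_condExp]
      simp [condExpVec, hy]

lemma Mp0_ae_eq_smul_condExpVec [IsProbabilityMeasure P] {M : Proc P T d} (hM : M ∈ Mp0 P 𝓕 d p)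
    {ξ : Ω → ℝ} {x : Ω → Vec d} (hξ : StronglyMeasurable[𝓕 ⊥] ξ)
    (hx : StronglyMeasurable[𝓕 ⊤] x) (hxi : Integrable x P)
    (hMT : M ⊤ =ᵐ[P] fun ω => ξ ω • x ω) (t : Time T) :
    M t =ᵐ[P] fun ω => ξ ω • condExpVec (𝓕 t) P x ω := by
  rcases eq_or_lt_of_le (le_top : t ≤ ⊤) with rfl | ht
  · rwa [condExpVec_of_stronglyMeasurable (𝓕.le _) hxi hx]
  · obtain ⟨h1, h2⟩ := genCondExp_of_smul hξ hxi hMT t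
    rwa [← (hM.2 t ⊤ ht).unique (𝓕.le t) h1] at h2

/-- `M ⊤` and `y` are each written as an `𝓕_0`-measurable scalar times an integrable vector, so that
the lemma on differences applies; the vector for `y` is itself `𝓕_0`-measurable, hence fixed by
conditioning. -/
lemma isGenCondExp_sub_Mp0 [IsProbabilityMeasure P] (hp : 1 < p) {y : Ω →ₘ[P] Vec d}
    (hy : y ∈ L0 (𝓕 ⊥) P d) {M : Proc P T d} (hM : M ∈ Mp0 P 𝓕 d p) (t : Time T) :
    IsGenCondExp (𝓕 t) P (y - M ⊤) (y - M t) := by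
  obtain ⟨ξ, x, hξ, hx, hxp, hMT⟩ := mem_LpMod_of_mem_Sp hp hM.1.1 ⊤
  obtain ⟨ζ, z, hζ, hz, hzp, hyz⟩ := exists_smul_of_mem_L0 (p := p) hy
  have hxi := hxp.integrable hp.le
  have hzi := hzp.integrable hp.le
  have hbot : 𝓕 ⊥ ≤ 𝓕 t := 𝓕.mono bot_le
  refine isGenCondExp_sub (𝓕.le t) (hζ.mono hbot) hzi (hξ.mono hbot) hxi hyz hMT ?_
    (Mp0_ae_eq_smul_condExpVec hM hξ hx hxi hMT t)
  rwa [condExpVec_of_stronglyMeasurable (𝓕.le t) hzi (hz.mono hbot)]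

lemma proj_mem_LpMod [IsProbabilityMeasure P] (hp : 1 < p) {Y M : Proc P T d}
    (hY : Y ∈ Sp P 𝓕 d p) (hM : M ∈ Mp0 P 𝓕 d p) : Y ⊥ - M ⊤ ∈ LpMod P 𝓕 d p :=
  sub_mem_LpMod (mem_LpMod_of_mem_Sp hp hY ⊥) (mem_LpMod_of_mem_Sp hp hM.1.1 ⊤)

lemma genCondExp_proj [IsProbabilityMeasure P] (hp : 1 < p) {Y M : Proc P T d}
    (hY : Y ∈ Sp P 𝓕 d p) (hM : M ∈ Mp0 P 𝓕 d p) (t : Time T) :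
    genCondExp (𝓕 t) P (Y ⊥ - M ⊤) = Y ⊥ - M t :=
  (isGenCondExp_sub_Mp0 hp (bot_mem_L0_of_mem_Sp hY) hM t).genCondExp_eq (𝓕.le t)

lemma MV_proj [IsProbabilityMeasure P] (hp : 1 < p) {Y M : Proc P T d}
    (hY : Y ∈ Sp P 𝓕 d p) (hM : M ∈ Mp0 P 𝓕 d p) : MV P 𝓕 (Y ⊥ - M ⊤) = M := by
  funext t
  rw [MV, genCondExp_proj hp hY hM, genCondExp_proj hp hY hM, hM.1.2]
  abel

end Modules

end BSE

/-! ### Fixed points of `G` and solutions of the BSE. -/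

theorem theorem4p1 {Ω : Type*} [mΩ : MeasurableSpace Ω] (P : Measure Ω) [IsProbabilityMeasure P]
    {T : ℝ≥0} {d : ℕ} (𝓕 : Filtration (BSE.Time T) mΩ) (h𝓕 : BSE.UsualConditions P 𝓕)
    (p : ℝ≥0∞) (hp : 1 < p)
    -- the generator `F : S^p × M^p_0 → S^p_0`; its values off this domain play no role
    (F : BSE.Proc P T d → BSE.Proc P T d → BSE.Proc P T d)
    (hF : ∀ Y ∈ BSE.Sp P 𝓕 d p, ∀ M ∈ BSE.Mp0 P 𝓕 d p, F Y M ∈ BSE.Sp0 P 𝓕 d p)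
    (hS : BSE.ConditionS P 𝓕 p F)
    (ξ : Ω →ₘ[P] BSE.Vec d) (hξ : ξ ∈ BSE.LpMod P 𝓕 d p) :
    -- the conditional expectations exist and `Y^V`, `M^V` are what they should be
    (∀ V ∈ BSE.LpMod P 𝓕 d p,
      (∀ t, ∀ Z : Ω →ₘ[P] BSE.Vec d,
        BSE.IsGenCondExp (𝓕 t) P V Z ↔ Z = BSE.genCondExp (𝓕 t) P V) ∧
      BSE.genCondExp (𝓕 ⊥) P V ∈ BSE.L0 (𝓕 ⊥) P d ∧
      BSE.MV P 𝓕 V ∈ BSE.Mp0 P 𝓕 d p ∧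
      BSE.IsForwardSol P 𝓕 p F (BSE.genCondExp (𝓕 ⊥) P V) (BSE.MV P 𝓕 V) (BSE.YV P 𝓕 p F V)) ∧
    -- `φ`, `π` and `G` map between the stated spaces
    Set.MapsTo (BSE.phi P 𝓕 p F) (BSE.LpMod P 𝓕 d p) (BSE.Sp P 𝓕 d p ×ˢ BSE.Mp0 P 𝓕 d p) ∧
    Set.MapsTo (BSE.proj P) (BSE.Sp P 𝓕 d p ×ˢ BSE.Mp0 P 𝓕 d p) (BSE.LpMod P 𝓕 d p) ∧
    Set.MapsTo (BSE.G P 𝓕 p F ξ) (BSE.LpMod P 𝓕 d p) (BSE.LpMod P 𝓕 d p) ∧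
    -- `V = π(φ(V))`; in particular `φ` is injective
    (∀ V ∈ BSE.LpMod P 𝓕 d p, BSE.proj P (BSE.phi P 𝓕 p F V) = V) ∧
    Set.InjOn (BSE.phi P 𝓕 p F) (BSE.LpMod P 𝓕 d p) ∧
    -- `φ` maps fixed points of `G` to solutions
    (∀ V ∈ BSE.FixG P 𝓕 p F ξ, BSE.phi P 𝓕 p F V ∈ BSE.Sol P 𝓕 p F ξ) ∧
    -- if `(Y,M)` is a solution, then `π(Y,M)` is a fixed point of `G` and `φ(π(Y,M)) = (Y,M)`
    (∀ YM ∈ BSE.Sol P 𝓕 p F ξ, BSE.proj P YM ∈ BSE.FixG P 𝓕 p F ξ ∧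
      BSE.phi P 𝓕 p F (BSE.proj P YM) = YM) ∧
    -- hence `φ` and `π` are mutually inverse bijections between fixed points and solutions
    Set.BijOn (BSE.phi P 𝓕 p F) (BSE.FixG P 𝓕 p F ξ) (BSE.Sol P 𝓕 p F ξ) ∧
    Set.BijOn (BSE.proj P) (BSE.Sol P 𝓕 p F ξ) (BSE.FixG P 𝓕 p F ξ) ∧
    Set.InvOn (BSE.proj P) (BSE.phi P 𝓕 p F) (BSE.FixG P 𝓕 p F ξ) (BSE.Sol P 𝓕 p F ξ) ∧
    -- `V` is the unique fixed point of `G` iff `φ(V)` is the unique solution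
    (∀ V ∈ BSE.LpMod P 𝓕 d p,
      (V ∈ BSE.FixG P 𝓕 p F ξ ∧ ∀ W ∈ BSE.FixG P 𝓕 p F ξ, W = V) ↔
        (BSE.phi P 𝓕 p F V ∈ BSE.Sol P 𝓕 p F ξ ∧
          ∀ YM ∈ BSE.Sol P 𝓕 p F ξ, YM = BSE.phi P 𝓕 p F V)) := by
  have hE0 : ∀ V ∈ BSE.LpMod P 𝓕 d p, BSE.genCondExp (𝓕 ⊥) P V ∈ BSE.L0 (𝓕 ⊥) P d :=
    fun V hV => BSE.genCondExp_bot_mem_L0 hp hV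
  have hMV : ∀ V ∈ BSE.LpMod P 𝓕 d p, BSE.MV P 𝓕 V ∈ BSE.Mp0 P 𝓕 d p :=
    fun V hV => BSE.MV_mem_Mp0 h𝓕 hp hV
  have hYV : ∀ V ∈ BSE.LpMod P 𝓕 d p, BSE.IsForwardSol P 𝓕 p F (BSE.genCondExp (𝓕 ⊥) P V)
      (BSE.MV P 𝓕 V) (BSE.YV P 𝓕 p F V) := fun V hV =>
    Classical.epsilon_spec (p := fun Y => BSE.IsForwardSol P 𝓕 p F (BSE.genCondExp (𝓕 ⊥) P V)
      (BSE.MV P 𝓕 V) Y) (hS _ (hE0 V hV) _ (hMV V hV)).exists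
  have hFV : ∀ V ∈ BSE.LpMod P 𝓕 d p,
      F (BSE.YV P 𝓕 p F V) (BSE.MV P 𝓕 V) ∈ BSE.Sp0 P 𝓕 d p := fun V hV =>
    hF _ (hYV V hV).1 _ (hMV V hV)
  have hphi : Set.MapsTo (BSE.phi P 𝓕 p F) (BSE.LpMod P 𝓕 d p)
      (BSE.Sp P 𝓕 d p ×ˢ BSE.Mp0 P 𝓕 d p) := fun V hV =>
    Set.mem_prod.2 ⟨(hYV V hV).1, hMV V hV⟩
  have hproj : Set.MapsTo (BSE.proj P) (BSE.Sp P 𝓕 d p ×ˢ BSE.Mp0 P 𝓕 d p)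
      (BSE.LpMod P 𝓕 d p) := fun YM hYM =>
    BSE.proj_mem_LpMod hp (Set.mem_prod.1 hYM).1 (Set.mem_prod.1 hYM).2
  have hG : Set.MapsTo (BSE.G P 𝓕 p F ξ) (BSE.LpMod P 𝓕 d p) (BSE.LpMod P 𝓕 d p) := fun V hV =>
    BSE.add_mem_LpMod hξ (BSE.mem_LpMod_of_mem_Sp hp (hFV V hV).1 ⊤)
  have hleft : ∀ V ∈ BSE.LpMod P 𝓕 d p, BSE.proj P (BSE.phi P 𝓕 p F V) = V := by
    intro V hV
    change BSE.YV P 𝓕 p F V ⊥ - BSE.MV P 𝓕 V ⊤ = V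
    rw [(hYV V hV).2 ⊥, (hFV V hV).2, (hMV V hV).1.2, BSE.MV, BSE.genCondExp_top hp hV]
    abel
  have hinj : Set.InjOn (BSE.phi P 𝓕 p F) (BSE.LpMod P 𝓕 d p) := fun V hV W hW h => by
    rw [← hleft V hV, h, hleft W hW]
  have hfix : ∀ V ∈ BSE.FixG P 𝓕 p F ξ, BSE.phi P 𝓕 p F V ∈ BSE.Sol P 𝓕 p F ξ := by
    rintro V ⟨hV, hfixV⟩
    refine ⟨hphi hV, fun t => ?_⟩
    change BSE.YV P 𝓕 p F V t + F (BSE.YV P 𝓕 p F V) (BSE.MV P 𝓕 V) t + BSE.MV P 𝓕 V t =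
      BSE.G P 𝓕 p F ξ V + BSE.MV P 𝓕 V ⊤
    rw [hfixV, (hYV V hV).2 t, BSE.MV, BSE.MV, BSE.genCondExp_top hp hV]
    abel
  have hsol : ∀ YM ∈ BSE.Sol P 𝓕 p F ξ, BSE.proj P YM ∈ BSE.FixG P 𝓕 p F ξ ∧
      BSE.phi P 𝓕 p F (BSE.proj P YM) = YM := by
    rintro ⟨Y, M⟩ ⟨hYM, heq⟩
    obtain ⟨hY, hM⟩ : Y ∈ BSE.Sp P 𝓕 d p ∧ M ∈ BSE.Mp0 P 𝓕 d p := Set.mem_prod.1 hYM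
    have hV := hproj hYM
    have hMeq : BSE.MV P 𝓕 (Y ⊥ - M ⊤) = M := BSE.MV_proj hp hY hM
    have hEeq : BSE.genCondExp (𝓕 ⊥) P (Y ⊥ - M ⊤) = Y ⊥ := by
      rw [BSE.genCondExp_proj hp hY hM, hM.1.2, sub_zero]
    -- The BSE at time 0, where `F` and `M` vanish: its constant right side is `Y_0`, which turns
    -- the backward equation into the forward one.
    have h0 : Y ⊥ = ξ + F Y M ⊤ + M ⊤ := by
      have h : Y ⊥ + F Y M ⊥ + M ⊥ = ξ + F Y M ⊤ + M ⊤ := heq ⊥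
      rwa [(hF Y hY M hM).2, hM.1.2, add_zero, add_zero] at h
    have hYsol : BSE.IsForwardSol P 𝓕 p F (Y ⊥) M Y := by
      refine ⟨hY, fun t => ?_⟩
      have := (heq t).trans h0.symm
      simp only at this
      rw [← this]
      abel
    -- The uniqueness half of (S) enters here: both processes solve the forward equation with data
    -- `Y_0` and `M`.
    have hYeq : BSE.YV P 𝓕 p F (Y ⊥ - M ⊤) = Y := by
      have h := hYV _ hV
      change BSE.IsForwardSol P 𝓕 p F (BSE.genCondExp (𝓕 ⊥) P (Y ⊥ - M ⊤))
        (BSE.MV P 𝓕 (Y ⊥ - M ⊤)) (BSE.YV P 𝓕 p F (Y ⊥ - M ⊤)) at h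
      rw [hEeq, hMeq] at h
      exact (hS _ (BSE.bot_mem_L0_of_mem_Sp hY) _ hM).unique h hYsol
    refine ⟨⟨hV, ?_⟩, Prod.ext hYeq hMeq⟩
    change ξ + F (BSE.YV P 𝓕 p F (Y ⊥ - M ⊤)) (BSE.MV P 𝓕 (Y ⊥ - M ⊤)) ⊤ = Y ⊥ - M ⊤
    rw [hYeq, hMeq, h0]
    abel
  have hinv : Set.InvOn (BSE.proj P) (BSE.phi P 𝓕 p F) (BSE.FixG P 𝓕 p F ξ)
      (BSE.Sol P 𝓕 p F ξ) :=
    ⟨fun V hV => hleft V hV.1, fun YM hYM => (hsol YM hYM).2⟩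
  have hmaps : Set.MapsTo (BSE.proj P) (BSE.Sol P 𝓕 p F ξ) (BSE.FixG P 𝓕 p F ξ) :=
    fun YM hYM => (hsol YM hYM).1
  refine ⟨fun V hV => ⟨BSE.isGenCondExp_iff hp hV, hE0 V hV, hMV V hV, hYV V hV⟩,
    hphi, hproj, hG, hleft, hinj, hfix, hsol, hinv.bijOn hfix hmaps,
    hinv.symm.bijOn hmaps hfix, hinv, fun V hV => ⟨fun ⟨h1, h2⟩ => ⟨hfix V h1, fun YM hYM => ?_⟩,
      fun ⟨h1, h2⟩ => ⟨?_, fun W hW => ?_⟩⟩⟩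
  · rw [← h2 _ (hmaps hYM), (hsol YM hYM).2]
  · simpa only [hleft V hV] using hmaps h1
  · exact hinj hW.1 hV (h2 _ (hfix W hW))
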